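/- Let $\alpha>2$, $\theta>0$ and $h>0$. For every density $\lambda>0$ let the base stations (BSs) be located at the points $x_0,x_1,\dots$ of a homogeneous Poisson point process of density $\lambda$ in $\mathbb{R}^2$, and let their power fading gains $g_0,g_1,\dots$ be i.i.d. exponential random variables with mean $1$, independent of the locations. All BSs have height $h$, and the path loss at horizontal distance $r$ is $\ell(r,h)=(r^2+h^2)^{-\alpha/2}$. The typical user, at the origin, is served by its closest BS, with (almost surely unique) index $i_*$, and all other BSs interfere. Define the coverage probability and the area spectral efficiency (ASE) by $$\mathrm{P}_{\mathrm{cov}}^{(\mathrm{C})}(\theta,\lambda)=\Pr\bigg[\frac{g_{i_*}\,\ell(\|x_{i_*}\|,h)}{\sum_{j\neq i_*}g_j\,\ell(\|x_j\|,h)}>\theta\bigg],\qquad \mathrm{ASE}^{(\mathrm{C})}(\theta,\lambda)=\lambda\,\mathrm{P}_{\mathrm{cov}}^{(\mathrm{C})}(\theta,\lambda)\,\log_2(1+\theta).$$ Let $\eta=\eta(\theta,1,1)$, where $\eta(s,m,r)={}_2F_1\big(m,-\tfrac2\alpha;1-\tfrac2\alpha;-\tfrac{s}{m r^\alpha}\big)$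 and ${}_2F_1$ denotes the principal branch, on $\mathbb{C}\setminus[1,\infty)$, of the Gauss hypergeometric function. Then the function $\lambda\mapsto\mathrm{ASE}^{(\mathrm{C})}(\theta,\lambda)$ on $(0,\infty)$ attains its maximum at exactly one point, namely $$\lambda_{\mathrm{opt}}^{(\mathrm{C})}=\frac{1}{\pi h^2(\eta-1)},$$ and the maximum is $$\mathrm{ASE}^{(\mathrm{C})}\big(\theta,\lambda_{\mathrm{opt}}^{(\mathrm{C})}\big)=\frac{e^{-1}\log_2(1+\theta)}{\pi h^2\,\eta\,(\eta-1)}.$$ In particular, there is a constant $C>0$ depending only on $\alpha$ and $\theta$ such that the maximum equals $C/h^2$ for every $h>0$. -/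

import Mathlib

noncomputable section

/-- `F` is the principal branch of the Gauss hypergeometric function with parameters `a, b, c`:
it is holomorphic on the plane cut along `[1, ∞)` and is the sum of the hypergeometric series in
the open unit disc. -/
def IsGaussHypergeometric (a b c : ℂ) (F : ℂ → ℂ) : Prop :=
  DifferentiableOn ℂ F {z : ℂ | 1 - z ∈ Complex.slitPlane} ∧
    ∀ z : ℂ, ‖z‖ < 1 → F z = ordinaryHypergeometric a b c z

open Classical in
/-- The Gauss hypergeometric function on the plane cut along `[1, ∞)`. The function
`ordinaryHypergeometric` is the sum of the series only, and `0` where the series diverges, so that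
it cannot be used outside the unit disc. -/
def gaussHypergeometric (a b c : ℂ) (z : ℂ) : ℂ :=
  if hF : ∃ F : ℂ → ℂ, IsGaussHypergeometric a b c F then hF.choose z else 0

/-- On the cut plane the value does not depend on the choice made in the definition. -/
theorem IsGaussHypergeometric.gaussHypergeometric_eq {a b c : ℂ} {F : ℂ → ℂ}
    (hF : IsGaussHypergeometric a b c F) {z : ℂ} (hz : 1 - z ∈ Complex.slitPlane) :
    gaussHypergeometric a b c z = F z := by
  have hex : ∃ F : ℂ → ℂ, IsGaussHypergeometric a b c F := ⟨F, hF⟩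
  have hG := hex.choose_spec
  have hopen : IsOpen {z : ℂ | 1 - z ∈ Complex.slitPlane} :=
    Complex.isOpen_slitPlane.preimage (by fun_prop)
  have hstar : StarConvex ℝ (0 : ℂ) {z : ℂ | 1 - z ∈ Complex.slitPlane} := by
    rw [starConvex_zero_iff]
    intro w hw t ht0 ht1
    have h1 := Complex.starConvex_one_slitPlane hw (sub_nonneg.2 ht1) ht0 (by ring)
    have h2 : 1 - t • w = (1 - t) • (1 : ℂ) + t • (1 - w) := by
      simp only [Complex.real_smul]
      push_cast
      ring
    simpa only [Set.mem_ofPred_eq, h2] using h1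
  have h0 : (0 : ℂ) ∈ {z : ℂ | 1 - z ∈ Complex.slitPlane} := by simp
  have hpre : IsPreconnected {z : ℂ | 1 - z ∈ Complex.slitPlane} :=
    (hstar.isPathConnected h0).isConnected.isPreconnected
  have heq : Set.EqOn hex.choose F {z : ℂ | 1 - z ∈ Complex.slitPlane} := by
    refine (hG.1.analyticOnNhd hopen).eqOn_of_preconnected_of_eventuallyEq
      (hF.1.analyticOnNhd hopen) hpre h0 ?_
    filter_upwards [Metric.ball_mem_nhds (0 : ℂ) one_pos] with w hw
    have hw' : ‖w‖ < 1 := by simpa using hw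
    rw [hG.2 w hw', hF.2 w hw']
  unfold gaussHypergeometric
  rw [dif_pos hex]
  exact heq hz

/-- `η(s, m, r) = ₂F₁(m, -2/α; 1 - 2/α; -s / (m r ^ α))`, for the path loss exponent `α`. -/
def eta (α s : ℝ) (m : ℕ) (r : ℝ) : ℝ :=
  (gaussHypergeometric (m : ℂ) ((-(2 / α) : ℝ) : ℂ) ((1 - 2 / α : ℝ) : ℂ)
    ((-(s / (m * r ^ α)) : ℝ) : ℂ)).re

/-- The path loss at horizontal distance `r` from a base station of height `h`. -/
def pathloss (α h r : ℝ) : ℝ := (r ^ 2 + h ^ 2) ^ (-(α / 2))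

section Network

variable {Ω : Type*} [MeasurableSpace Ω]

/-- The random points `x 0, x 1, …` of the plane form a homogeneous Poisson point process of
density `lam`: the numbers of points in pairwise disjoint bounded Borel sets are independent, and
the number of points in `B` has the Poisson distribution with mean `lam * volume B`. -/
structure IsPoissonPointProcess (lam : ℝ) (x : ℕ → Ω → EuclideanSpace ℝ (Fin 2))
    (P : MeasureTheory.Measure Ω) : Prop where
  measurable : ∀ i, Measurable (x i)
  law : ∀ (n : ℕ) (B : Fin n → Set (EuclideanSpace ℝ (Fin 2))),
    (∀ j, MeasurableSet (B j)) → (∀ j, Bornology.IsBounded (B j)) →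
    Pairwise (Function.onFun Disjoint B) → ∀ k : Fin n → ℕ,
      P {ω | ∀ j, Set.encard {i : ℕ | x i ω ∈ B j} = k j} =
        ∏ j, ProbabilityTheory.poissonMeasure
          (Real.toNNReal (lam * (MeasureTheory.volume (B j)).toReal)) {k j}

/-- Base stations at the points `x i` of a homogeneous Poisson point process of density `lam`,
marked by power fading gains `g i` (Rayleigh fading) which are i.i.d. exponential with mean `1`
and independent of the locations. -/
structure IsRayleighNetwork (lam : ℝ) (x : ℕ → Ω → EuclideanSpace ℝ (Fin 2)) (g : ℕ → Ω → ℝ)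
    (P : MeasureTheory.Measure Ω) : Prop where
  poisson : IsPoissonPointProcess lam x P
  measurable_gain : ∀ i, Measurable (g i)
  gain_law : ∀ i, P.map (g i) = ProbabilityTheory.expMeasure 1
  gain_indep : ProbabilityTheory.iIndepFun g P
  indep : ProbabilityTheory.IndepFun (fun ω i => x i ω) (fun ω i => g i ω) P

/-- The signal-to-interference ratio at the origin (the typical user) when the serving base
station is the `i`-th one and all the others interfere; values in `[0, ∞]`. -/
def sir (α h : ℝ) (x : ℕ → Ω → EuclideanSpace ℝ (Fin 2)) (g : ℕ → Ω → ℝ) (i : ℕ) (ω : Ω) :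
    ENNReal :=
  ENNReal.ofReal (g i ω * pathloss α h ‖x i ω‖) /
    ∑' j : {j : ℕ // j ≠ i}, ENNReal.ofReal (g j ω * pathloss α h ‖x j ω‖)

/-- The coverage probability for closest association: the probability that the ratio at the
origin exceeds `θ` when the origin is served by the (almost surely unique) base station which is
closest to it. -/
def coverageProbClosest (α h θ : ℝ) (x : ℕ → Ω → EuclideanSpace ℝ (Fin 2)) (g : ℕ → Ω → ℝ)
    (P : MeasureTheory.Measure Ω) : ℝ :=
  P.real {ω | ∃ i, (∀ j, ‖x i ω‖ ≤ ‖x j ω‖) ∧ ENNReal.ofReal θ < sir α h x g i ω}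

/-- The achievable area spectral efficiency for closest association. -/
def aseClosest (α h θ lam : ℝ) (x : ℕ → Ω → EuclideanSpace ℝ (Fin 2)) (g : ℕ → Ω → ℝ)
    (P : MeasureTheory.Measure Ω) : ℝ :=
  lam * coverageProbClosest α h θ x g P * Real.logb 2 (1 + θ)

end Network

/-- The optimal density of base stations for closest association. -/
def lamOpt (α h θ : ℝ) : ℝ := 1 / (Real.pi * h ^ 2 * (eta α θ 1 1 - 1))

end

section

open MeasureTheory Set Filter Topology ProbabilityTheory
open scoped ENNReal NNReal

/-! Write b = α/2 and K = ∫_1^∞ θu^(-b)/(1 + θu^(-b)) du. Everything follows from the closed form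
P_cov = exp(-πλh²K)/(1 + K) together with η = 1 + K. The ASE is then a positive constant times λ
exp(-πh²Kλ), whose unique maximizer is 1/(πh²K).

The identity η = 1 + K (`eta_one_one`) comes from an Euler-type integral that is holomorphic on the
cut plane and has the hypergeometric series as its expansion in the disc.

The coverage formula is proved by discretizing space, so that only the counts in disjoint bounded
sets are used and no density of the nearest distance is needed. The plane is cut into annuli of
equal area πε, so the counts are i.i.d. Poisson with mean r = λπε. Let A_k be the event that annulus
k holds exactly one point and all inner annuli are empty. On A_k the server is unique, and the
conditional coverage probability given the locations is the product of 1/(1 + θu_j^(-b)), where u_j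
is the ratio of the squared distances, height included, of interferer j and of the server. Replacing
u_j by bounds that depend only on annulus indices (`measure_coverageEvent_of_isFirstAnnulus`) leaves
a Laplace functional of independent Poisson counts, whose exponent is a Riemann sum for K
(`IsPoissonPointProcess.setLIntegral_negExp_tsum`). Summing over k gives geometric series. As r → 0
both bounds tend to the closed form, and the probability of missing every A_k tends to 0. -/

/-! ### The hypergeometric function as an integral. -/

/-- Both sides are the rising factorial of -d of length n + 1, split off at its last or at its first
factor. This collapses the hypergeometric coefficients to -d/(n - d). -/
theorem ascPochhammer_eval_neg_mul (d : ℂ) (n : ℕ) :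
    (ascPochhammer ℂ n).eval (-d) * (n - d) = -d * (ascPochhammer ℂ n).eval (1 - d) := by
  have h1 := ascPochhammer_succ_eval n (-d)
  have h2 : (ascPochhammer ℂ (n + 1)).eval (-d) = -d * (ascPochhammer ℂ n).eval (1 - d) := by
    rw [ascPochhammer_succ_left, Polynomial.eval_mul, Polynomial.eval_X, Polynomial.eval_comp]
    simp [add_comm, sub_eq_add_neg]
  rw [← h2, h1]
  ring

theorem ordinaryHypergeometric_one_eq_tsum {d : ℝ} (h0 : 0 < d) (h1 : d < 1) (z : ℂ) :
    ordinaryHypergeometric (1 : ℂ) ((-d : ℝ) : ℂ) ((1 - d : ℝ) : ℂ) z =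
      ∑' n : ℕ, (-d / (n - d) : ℂ) * z ^ n := by
  rw [ordinaryHypergeometric_eq_tsum]
  refine tsum_congr fun n => ?_
  have hn : (n : ℂ) - d ≠ 0 := by
    have : (n : ℝ) - d ≠ 0 := by
      rcases Nat.eq_zero_or_pos n with rfl | hn
      · simpa using h0.ne'
      · have : (1 : ℝ) ≤ n := by exact_mod_cast hn
        linarith
    exact_mod_cast this
  have hp : (ascPochhammer ℂ n).eval (1 - d : ℂ) ≠ 0 := by
    have : 0 < (ascPochhammer ℝ n).eval (1 - d) := ascPochhammer_pos n _ (by linarith)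
    have h2 : (ascPochhammer ℂ n).eval (((1 - d : ℝ)) : ℂ) =
        (((ascPochhammer ℝ n).eval (1 - d) : ℝ) : ℂ) := by
      rw [← ascPochhammer_map Complex.ofRealHom, Polynomial.eval_map]
      exact Polynomial.eval₂_at_apply Complex.ofRealHom _
    push_cast at h2
    rw [h2]
    exact_mod_cast this.ne'
  have hq := ascPochhammer_eval_neg_mul (d : ℂ) n
  have hf : (n.factorial : ℂ) ≠ 0 := by exact_mod_cast n.factorial_ne_zero
  rw [ascPochhammer_eval_one]
  push_cast
  rw [smul_eq_mul]
  congr 1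
  field_simp
  linear_combination hq

theorem one_sub_ofReal_mul_mem_slitPlane {z : ℂ} (hz : 1 - z ∈ Complex.slitPlane) {t : ℝ}
    (h0 : 0 ≤ t) (h1 : t ≤ 1) : 1 - z * t ∈ Complex.slitPlane := by
  have h := Complex.starConvex_one_slitPlane hz (sub_nonneg.2 h1) h0 (by ring)
  have h2 : 1 - z * t = (1 - t) • (1 : ℂ) + t • (1 - z) := by
    simp only [Complex.real_smul]
    push_cast
    ring
  rwa [h2]

/-- Compactness of a closed ball times [0, 1] keeps the denominators away from 0. This supplies the
domination for differentiating under the integral sign. -/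
theorem exists_le_norm_one_sub_mul {z₀ : ℂ} (hz : 1 - z₀ ∈ Complex.slitPlane) :
    ∃ s ∈ 𝓝 z₀, ∃ c : ℝ, 0 < c ∧ ∀ z ∈ s, ∀ t : ℝ, 0 ≤ t → t ≤ 1 → c ≤ ‖1 - z * t‖ := by
  have hopen : IsOpen {z : ℂ | 1 - z ∈ Complex.slitPlane} :=
    Complex.isOpen_slitPlane.preimage (by fun_prop)
  obtain ⟨ε, hε, hs⟩ := Metric.nhds_basis_closedBall.mem_iff.1 (hopen.mem_nhds hz)
  refine ⟨Metric.closedBall z₀ ε, Metric.closedBall_mem_nhds _ hε, ?_⟩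
  have hK : IsCompact (Metric.closedBall z₀ ε ×ˢ Icc (0 : ℝ) 1) :=
    (isCompact_closedBall _ _).prod isCompact_Icc
  obtain ⟨p, hp, hmin⟩ := hK.exists_isMinOn ⟨(z₀, 0), by simp [hε.le]⟩
    (f := fun p : ℂ × ℝ => ‖1 - p.1 * p.2‖) (by fun_prop)
  refine ⟨‖1 - p.1 * p.2‖, ?_, fun z hz t h0 h1 => hmin (a := (z, t)) ⟨hz, h0, h1⟩⟩
  exact norm_pos_iff.2 (Complex.slitPlane_ne_zero
    (one_sub_ofReal_mul_mem_slitPlane (hs hp.1) hp.2.1 hp.2.2))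

/-- Euler-type integral for `₂F₁(1, -1/b; 1 - 1/b; z)`. -/
noncomputable def hypergeometricIntegral (b : ℝ) (z : ℂ) : ℂ :=
  1 - z * ∫ u in Ioi (1 : ℝ), ((u ^ (-b) : ℝ) : ℂ) / (1 - z * (u ^ (-b) : ℝ))

theorem rpow_neg_mem_Icc {b u : ℝ} (hb : 0 < b) (hu : 1 < u) : 0 ≤ u ^ (-b) ∧ u ^ (-b) ≤ 1 :=
  ⟨by positivity, Real.rpow_le_one_of_one_le_of_nonpos hu.le (by linarith)⟩

theorem integrable_rpow_neg {b : ℝ} (hb : 1 < b) :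
    Integrable (fun u : ℝ => u ^ (-b)) (volume.restrict (Ioi 1)) :=
  integrableOn_Ioi_rpow_of_lt (by linarith) one_pos

theorem differentiableOn_hypergeometricIntegral {b : ℝ} (hb : 1 < b) :
    DifferentiableOn ℂ (hypergeometricIntegral b) {z : ℂ | 1 - z ∈ Complex.slitPlane} := by
  intro z₀ hz₀
  obtain ⟨s, hs, c, hc, hbd⟩ := exists_le_norm_one_sub_mul hz₀
  refine DifferentiableAt.differentiableWithinAt ?_
  have hmeas : ∀ z : ℂ, AEStronglyMeasurable
      (fun u : ℝ => ((u ^ (-b) : ℝ) : ℂ) / (1 - z * (u ^ (-b) : ℝ)))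
      (volume.restrict (Ioi 1)) := fun z =>
    Measurable.aestronglyMeasurable (by fun_prop)
  have hmeas' : AEStronglyMeasurable
      (fun u : ℝ => ((u ^ (-b) : ℝ) : ℂ) ^ 2 / (1 - z₀ * (u ^ (-b) : ℝ)) ^ 2)
      (volume.restrict (Ioi 1)) := Measurable.aestronglyMeasurable (by fun_prop)
  have hint : Integrable (fun u : ℝ => ((u ^ (-b) : ℝ) : ℂ) / (1 - z₀ * (u ^ (-b) : ℝ)))
      (volume.restrict (Ioi 1)) := by
    refine ((integrable_rpow_neg hb).div_const c).mono' (hmeas z₀) ?_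
    refine (ae_restrict_iff' measurableSet_Ioi).2 (Eventually.of_forall fun u hu => ?_)
    obtain ⟨h0, h1⟩ := rpow_neg_mem_Icc (by linarith : 0 < b) hu
    rw [norm_div, Complex.norm_real, Real.norm_of_nonneg h0]
    gcongr
    exact hbd z₀ (mem_of_mem_nhds hs) _ h0 h1
  have hD := hasDerivAt_integral_of_dominated_loc_of_deriv_le (𝕜 := ℂ)
    (μ := volume.restrict (Ioi (1 : ℝ)))
    (F := fun z u => ((u ^ (-b) : ℝ) : ℂ) / (1 - z * (u ^ (-b) : ℝ)))
    (F' := fun z u => ((u ^ (-b) : ℝ) : ℂ) ^ 2 / (1 - z * (u ^ (-b) : ℝ)) ^ 2)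
    (bound := fun u => u ^ (-b) / c ^ 2)
    hs (Eventually.of_forall hmeas) hint hmeas' ?_ ((integrable_rpow_neg hb).div_const _) ?_
  · unfold hypergeometricIntegral
    exact (differentiableAt_const _).sub (differentiableAt_id.mul hD.2.differentiableAt)
  · refine (ae_restrict_iff' measurableSet_Ioi).2 (Eventually.of_forall fun u hu z hz => ?_)
    obtain ⟨h0, h1⟩ := rpow_neg_mem_Icc (by linarith : 0 < b) hu
    rw [norm_div, norm_pow, norm_pow, Complex.norm_real, Real.norm_of_nonneg h0]
    have := hbd z hz _ h0 h1
    gcongr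
    nlinarith
  · refine (ae_restrict_iff' measurableSet_Ioi).2 (Eventually.of_forall fun u hu z hz => ?_)
    obtain ⟨h0, h1⟩ := rpow_neg_mem_Icc (by linarith : 0 < b) hu
    have hne : 1 - z * ((u ^ (-b) : ℝ) : ℂ) ≠ 0 :=
      norm_pos_iff.1 (hc.trans_le (hbd z hz _ h0 h1))
    have h := ((((hasDerivAt_id z).mul_const ((u ^ (-b) : ℝ) : ℂ)).const_sub 1).inv hne).const_mul
      ((u ^ (-b) : ℝ) : ℂ)
    simp only [id, one_mul, neg_neg] at h
    convert! h using 1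
    field_simp

/-- Expand the integrand as a geometric series in z u^(-b) and integrate termwise. The prefactor -z
moves term n of the integral to coefficient n + 1, and the leading 1 is coefficient 0. -/
theorem hypergeometricIntegral_eq_tsum {b : ℝ} (hb : 1 < b) {z : ℂ} (hz : ‖z‖ < 1) :
    hypergeometricIntegral b z = ∑' n : ℕ, (-(b⁻¹ : ℝ) / (n - (b⁻¹ : ℝ)) : ℂ) * z ^ n := by
  have hb0 : 0 < b := by linarith
  have hpow : ∀ (n : ℕ) (u : ℝ), u ∈ Ioi (1 : ℝ) → (u ^ (-b)) ^ (n + 1) = u ^ (-((n + 1) * b)) := by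
    intro n u hu
    rw [← Real.rpow_natCast, ← Real.rpow_mul (zero_le_one.trans (le_of_lt hu))]
    congr 1
    push_cast
    ring
  have hlt : ∀ n : ℕ, -(((n : ℝ) + 1) * b) < -1 := fun n => by
    have : (0 : ℝ) ≤ n := n.cast_nonneg
    nlinarith
  have hI : ∀ n : ℕ, ∫ u in Ioi (1 : ℝ), (u ^ (-b)) ^ (n + 1) = 1 / ((n + 1) * b - 1) := by
    intro n
    rw [setIntegral_congr_fun measurableSet_Ioi (hpow n), integral_Ioi_rpow_of_lt (hlt n) one_pos,
      Real.one_rpow, ← neg_div_neg_eq]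
    congr 1 <;> ring
  have hint : ∀ n : ℕ, IntegrableOn (fun u : ℝ => (u ^ (-b)) ^ (n + 1)) (Ioi 1) := fun n =>
    (integrableOn_Ioi_rpow_of_lt (hlt n) one_pos).congr_fun (fun u hu => (hpow n u hu).symm)
      measurableSet_Ioi
  have hnorm : ∀ n : ℕ, ∫ u in Ioi (1 : ℝ), ‖z ^ n * (((u ^ (-b)) ^ (n + 1) : ℝ) : ℂ)‖ =
      ‖z‖ ^ n * (1 / ((n + 1) * b - 1)) := by
    intro n
    rw [← hI n, ← integral_const_mul]
    refine setIntegral_congr_fun measurableSet_Ioi fun u hu => ?_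
    have := (rpow_neg_mem_Icc hb0 hu).1
    simp only [norm_mul, norm_pow, Complex.norm_real]
    rw [Real.norm_of_nonneg this]
  have hs := hasSum_integral_of_summable_integral_norm (μ := volume.restrict (Ioi (1 : ℝ)))
    (F := fun (n : ℕ) (u : ℝ) => z ^ n * (((u ^ (-b)) ^ (n + 1) : ℝ) : ℂ))
    (fun n => (hint n).ofReal.const_mul _) (by
      simp_rw [hnorm]
      refine Summable.of_nonneg_of_le (fun n => ?_) (fun n => ?_)
        ((summable_geometric_of_lt_one (norm_nonneg z) hz).mul_right (1 / (b - 1)))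
      · have := hlt n
        exact mul_nonneg (by positivity) (one_div_nonneg.2 (by linarith))
      · have : (0 : ℝ) ≤ n := n.cast_nonneg
        gcongr
        nlinarith)
  have hval : ∀ n : ℕ, ∫ u in Ioi (1 : ℝ), z ^ n * (((u ^ (-b)) ^ (n + 1) : ℝ) : ℂ) =
      z ^ n * ((1 / ((n + 1) * b - 1) : ℝ) : ℂ) := by
    intro n
    rw [integral_const_mul, integral_complex_ofReal, hI]
  simp_rw [hval] at hs
  have hgeom : ∫ u in Ioi (1 : ℝ), ∑' n : ℕ, z ^ n * (((u ^ (-b)) ^ (n + 1) : ℝ) : ℂ) =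
      ∫ u in Ioi (1 : ℝ), ((u ^ (-b) : ℝ) : ℂ) / (1 - z * (u ^ (-b) : ℝ)) := by
    refine setIntegral_congr_fun measurableSet_Ioi fun u hu => ?_
    obtain ⟨h0, h1⟩ := rpow_neg_mem_Icc hb0 hu
    have hlt1 : ‖z * ((u ^ (-b) : ℝ) : ℂ)‖ < 1 := by
      rw [norm_mul, Complex.norm_real, Real.norm_of_nonneg h0]
      nlinarith [norm_nonneg z]
    have h := (hasSum_geometric_of_norm_lt_one hlt1).mul_left ((u ^ (-b) : ℝ) : ℂ)
    rw [div_eq_mul_inv, ← h.tsum_eq]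
    refine tsum_congr fun n => ?_
    push_cast
    ring
  rw [hgeom] at hs
  have hs2 := (hs.mul_left (-z))
  have hs3 : HasSum (fun n : ℕ => (-(b⁻¹ : ℝ) / (((n + 1 : ℕ) : ℂ) - (b⁻¹ : ℝ)) : ℂ) * z ^ (n + 1))
      (-z * ∫ u in Ioi (1 : ℝ), ((u ^ (-b) : ℝ) : ℂ) / (1 - z * (u ^ (-b) : ℝ))) := by
    convert! hs2 using 2 with n
    have h1 := hlt n
    have h2 : ((n : ℂ) + 1) * b - 1 ≠ 0 := by
      have : ((n : ℝ) + 1) * b - 1 ≠ 0 := by linarith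
      exact_mod_cast this
    have h3 : (b : ℂ) ≠ 0 := by exact_mod_cast hb0.ne'
    push_cast
    have h4 : ((n : ℂ) + 1) - (b : ℂ)⁻¹ = (((n : ℂ) + 1) * b - 1) / b := by field_simp
    rw [h4]
    field_simp
    ring
  have hs4 := (hasSum_nat_add_iff' (f := fun n : ℕ =>
    (-(b⁻¹ : ℝ) / ((n : ℂ) - (b⁻¹ : ℝ)) : ℂ) * z ^ n) (g := hypergeometricIntegral b z) 1).1 (by
      convert! hs3 using 1
      have h3 : (b : ℂ) ≠ 0 := by exact_mod_cast hb0.ne'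
      simp [hypergeometricIntegral, h3])
  exact hs4.tsum_eq.symm

theorem isGaussHypergeometric_hypergeometricIntegral {b : ℝ} (hb : 1 < b) :
    IsGaussHypergeometric 1 ((-b⁻¹ : ℝ) : ℂ) ((1 - b⁻¹ : ℝ) : ℂ) (hypergeometricIntegral b) := by
  refine ⟨differentiableOn_hypergeometricIntegral hb, fun z hz => ?_⟩
  rw [hypergeometricIntegral_eq_tsum hb hz,
    ordinaryHypergeometric_one_eq_tsum (by positivity) (inv_lt_one_of_one_lt₀ hb)]

/-- The interference integrand, in terms of the ratio of squared distances. -/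
noncomputable def interferenceKernel (b θ u : ℝ) : ℝ := θ * u ^ (-b) / (1 + θ * u ^ (-b))

/-- For θ ≥ 1 the point -θ lies outside the disc of convergence, so uniqueness of the continuation
to the cut plane is what identifies the value. -/
theorem eta_one_one {α θ : ℝ} (hα : 2 < α) (hθ : 0 < θ) :
    eta α θ 1 1 = 1 + ∫ u in Ioi (1 : ℝ), interferenceKernel (α / 2) θ u := by
  have hb : 1 < α / 2 := by linarith
  have hslit : 1 - ((-θ : ℝ) : ℂ) ∈ Complex.slitPlane := by
    have : 1 - ((-θ : ℝ) : ℂ) = ((1 + θ : ℝ) : ℂ) := by push_cast; ring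
    rw [this, Complex.ofReal_mem_slitPlane]
    linarith
  have h := (isGaussHypergeometric_hypergeometricIntegral hb).gaussHypergeometric_eq hslit
  rw [inv_div] at h
  unfold eta
  rw [Nat.cast_one, Real.one_rpow, Nat.cast_one, mul_one, div_one, h, hypergeometricIntegral]
  have h2 : ((-θ : ℝ) : ℂ) * ∫ u in Ioi (1 : ℝ), ((u ^ (-(α / 2)) : ℝ) : ℂ) /
      (1 - ((-θ : ℝ) : ℂ) * (u ^ (-(α / 2)) : ℝ)) =
      ((-∫ u in Ioi (1 : ℝ), interferenceKernel (α / 2) θ u : ℝ) : ℂ) := by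
    rw [← integral_neg, ← integral_complex_ofReal, ← integral_const_mul]
    congr 1
    ext u
    unfold interferenceKernel
    push_cast
    ring
  rw [h2, Complex.sub_re, Complex.one_re, Complex.ofReal_re]
  ring

/-! ### The interference kernel and its Riemann sums. -/

section Kernel

variable {b θ : ℝ}

theorem interferenceKernel_nonneg (hθ : 0 < θ) {u : ℝ} (hu : 0 < u) :
    0 ≤ interferenceKernel b θ u := by
  unfold interferenceKernel
  positivity

theorem interferenceKernel_pos (hθ : 0 < θ) {u : ℝ} (hu : 0 < u) :
    0 < interferenceKernel b θ u := by
  unfold interferenceKernel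
  positivity

theorem interferenceKernel_le_one (hθ : 0 < θ) {u : ℝ} (hu : 0 < u) :
    interferenceKernel b θ u ≤ 1 := by
  unfold interferenceKernel
  have : 0 < u ^ (-b) := by positivity
  rw [div_le_one (by positivity)]
  linarith

theorem antitoneOn_interferenceKernel (hb : 1 < b) (hθ : 0 < θ) :
    AntitoneOn (interferenceKernel b θ) (Ioi 0) := by
  intro u hu v hv huv
  have h : v ^ (-b) ≤ u ^ (-b) := Real.rpow_le_rpow_of_nonpos hu huv (by linarith)
  have h1 : 0 < v ^ (-b) := Real.rpow_pos_of_pos hv _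
  have h2 : 0 < u ^ (-b) := Real.rpow_pos_of_pos hu _
  unfold interferenceKernel
  rw [div_le_div_iff₀ (by positivity) (by positivity)]
  nlinarith

theorem integrableOn_interferenceKernel (hb : 1 < b) (hθ : 0 < θ) :
    IntegrableOn (interferenceKernel b θ) (Ioi 1) := by
  refine ((integrable_rpow_neg hb).const_mul θ).mono' ?_ ?_
  · exact Measurable.aestronglyMeasurable (by unfold interferenceKernel; fun_prop)
  · refine (ae_restrict_iff' measurableSet_Ioi).2 (Eventually.of_forall fun u hu => ?_)
    have hu0 : 0 < u := one_pos.trans hu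
    rw [Real.norm_of_nonneg (interferenceKernel_nonneg hθ hu0)]
    have : 0 < u ^ (-b) := by positivity
    exact div_le_self (by positivity) (le_add_of_nonneg_right (by positivity))

theorem integral_interferenceKernel_pos (hb : 1 < b) (hθ : 0 < θ) :
    0 < ∫ u in Ioi (1 : ℝ), interferenceKernel b θ u := by
  rw [setIntegral_pos_iff_support_of_nonneg_ae _ (integrableOn_interferenceKernel hb hθ)]
  · have : Function.support (interferenceKernel b θ) ∩ Ioi 1 = Ioi 1 :=
      inter_eq_right.2 fun u hu => (interferenceKernel_pos hθ (one_pos.trans hu)).ne'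
    simp [this]
  · refine (ae_restrict_iff' measurableSet_Ioi).2 (Eventually.of_forall fun u hu => ?_)
    exact interferenceKernel_nonneg hθ (one_pos.trans hu)

theorem intervalIntegral_interferenceKernel_scale {τ : ℝ} (hτ : 0 < τ) (n : ℕ) :
    τ * ∫ y in (0 : ℝ)..(0 + n), interferenceKernel b θ (1 + τ * y) =
      ∫ u in (1 : ℝ)..(1 + τ * n), interferenceKernel b θ u := by
  rw [intervalIntegral.integral_comp_add_mul _ hτ.ne', smul_eq_mul, mul_inv_cancel_left₀ hτ.ne']
  simp

theorem antitoneOn_interferenceKernel_scale (hb : 1 < b) (hθ : 0 < θ) {τ : ℝ} (hτ : 0 < τ)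
    (s : ℝ) : AntitoneOn (fun y => interferenceKernel b θ (1 + τ * y)) (Icc 0 s) := by
  intro y hy z hz hyz
  have h0 : 0 ≤ τ * y := mul_nonneg hτ.le hy.1
  have h1 : τ * y ≤ τ * z := by gcongr
  exact antitoneOn_interferenceKernel hb hθ (mem_Ioi.2 (by linarith)) (mem_Ioi.2 (by linarith))
    (by linarith)

theorem intervalIntegral_le_riemannSum (hb : 1 < b) (hθ : 0 < θ) {τ : ℝ} (hτ : 0 < τ) (n : ℕ) :
    ∫ u in (1 : ℝ)..(1 + τ * n), interferenceKernel b θ u ≤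
      τ * ∑ i ∈ Finset.range n, interferenceKernel b θ (1 + τ * i) := by
  rw [← intervalIntegral_interferenceKernel_scale hτ]
  gcongr
  simpa using (antitoneOn_interferenceKernel_scale hb hθ hτ _).integral_le_sum (a := n) (x₀ := 0)

theorem riemannSum_succ_le_integral (hb : 1 < b) (hθ : 0 < θ) {τ : ℝ} (hτ : 0 < τ) (n : ℕ) :
    τ * ∑ i ∈ Finset.range n, interferenceKernel b θ (1 + τ * (i + 1)) ≤
      ∫ u in Ioi (1 : ℝ), interferenceKernel b θ u := by
  have h1 : τ * ∑ i ∈ Finset.range n, interferenceKernel b θ (1 + τ * (i + 1)) ≤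
      ∫ u in (1 : ℝ)..(1 + τ * n), interferenceKernel b θ u := by
    rw [← intervalIntegral_interferenceKernel_scale hτ]
    gcongr
    simpa using (antitoneOn_interferenceKernel_scale hb hθ hτ _).sum_le_integral (a := n) (x₀ := 0)
  refine h1.trans ?_
  rw [intervalIntegral.integral_of_le (by nlinarith [n.cast_nonneg (α := ℝ)])]
  refine setIntegral_mono_set (integrableOn_interferenceKernel hb hθ) ?_
    (Eventually.of_forall fun u hu => hu.1)
  refine (ae_restrict_iff' measurableSet_Ioi).2 (Eventually.of_forall fun u hu => ?_)
  exact interferenceKernel_nonneg hθ (one_pos.trans hu)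

theorem summable_interferenceKernel (hb : 1 < b) (hθ : 0 < θ) {τ : ℝ} (hτ : 0 < τ) :
    Summable fun i : ℕ => interferenceKernel b θ (1 + τ * i) := by
  rw [← summable_nat_add_iff 1]
  refine summable_of_sum_range_le (c := τ⁻¹ * ∫ u in Ioi (1 : ℝ), interferenceKernel b θ u)
    (fun i => interferenceKernel_nonneg hθ (by positivity)) fun n => ?_
  rw [le_inv_mul_iff₀ hτ]
  simpa using riemannSum_succ_le_integral hb hθ hτ n

/-- For a decreasing kernel the right-endpoint sum lies below the integral; the extra left-endpoint
term is at most τ because the kernel is at most 1. -/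
theorem riemannSum_le_integral (hb : 1 < b) (hθ : 0 < θ) {τ : ℝ} (hτ : 0 < τ) :
    τ * ∑' i : ℕ, interferenceKernel b θ (1 + τ * i) ≤
      τ + ∫ u in Ioi (1 : ℝ), interferenceKernel b θ u := by
  have hs := summable_interferenceKernel hb hθ hτ
  rw [hs.tsum_eq_zero_add, mul_add]
  have h1 : interferenceKernel b θ (1 + τ * (0 : ℕ)) ≤ 1 :=
    interferenceKernel_le_one hθ (by simp)
  have h2 : τ * ∑' i : ℕ, interferenceKernel b θ (1 + τ * (i + 1 : ℕ)) ≤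
      ∫ u in Ioi (1 : ℝ), interferenceKernel b θ u := by
    rw [mul_comm, ← le_div_iff₀ hτ]
    refine Real.tsum_le_of_sum_range_le (fun i => interferenceKernel_nonneg hθ (by positivity))
      fun n => ?_
    rw [le_div_iff₀ hτ, mul_comm]
    simpa using riemannSum_succ_le_integral hb hθ hτ n
  nlinarith

theorem integral_le_riemannSum (hb : 1 < b) (hθ : 0 < θ) {τ : ℝ} (hτ : 0 < τ) :
    ∫ u in Ioi (1 : ℝ), interferenceKernel b θ u ≤
      τ * ∑' i : ℕ, interferenceKernel b θ (1 + τ * i) := by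
  have hlim : Tendsto (fun n : ℕ => ∫ u in (1 : ℝ)..(1 + τ * n), interferenceKernel b θ u) atTop
      (𝓝 (∫ u in Ioi (1 : ℝ), interferenceKernel b θ u)) :=
    intervalIntegral_tendsto_integral_Ioi _ (integrableOn_interferenceKernel hb hθ)
      (tendsto_const_nhds.add_atTop
        (tendsto_natCast_atTop_atTop.const_mul_atTop hτ))
  refine le_of_tendsto' hlim fun n => (intervalIntegral_le_riemannSum hb hθ hτ n).trans ?_
  gcongr
  exact (summable_interferenceKernel hb hθ hτ).sum_le_tsum _
    fun i _ => interferenceKernel_nonneg hθ (by positivity)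

/-- Dropping the first two terms of the left-endpoint sum costs at most 2τ. The shift by two is the
one produced by the upper bound on distance ratios between annuli. -/
theorem integral_sub_le_shifted_riemannSum (hb : 1 < b) (hθ : 0 < θ) {τ : ℝ} (hτ : 0 < τ) :
    (∫ u in Ioi (1 : ℝ), interferenceKernel b θ u) - 2 * τ ≤
      τ * ∑' i : ℕ, interferenceKernel b θ (1 + τ * (i + 2 : ℕ)) := by
  have hs := summable_interferenceKernel hb hθ hτ
  have h := integral_le_riemannSum hb hθ hτ
  rw [← hs.sum_add_tsum_nat_add 2, mul_add] at h
  have h1 : ∑ i ∈ Finset.range 2, interferenceKernel b θ (1 + τ * i) ≤ 2 := by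
    refine (Finset.sum_le_card_nsmul _ _ 1 fun i _ => ?_).trans (by simp)
    exact interferenceKernel_le_one hθ (by positivity)
  nlinarith

end Kernel

/-! ### Maximizing l exp(-al). -/

/-- This is the strict inequality x + 1 < exp x at x = al - 1, which is nonzero exactly off the
maximizer; no derivative is needed. -/
theorem mul_exp_neg_mul_lt {a l : ℝ} (ha : 0 < a) (hne : l ≠ 1 / a) :
    l * Real.exp (-(a * l)) < 1 / a * Real.exp (-1) := by
  have h1 : a * l - 1 ≠ 0 := fun h => hne (by field_simp; linarith)
  have h2 := Real.add_one_lt_exp h1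
  have h3 : Real.exp (a * l - 1) = Real.exp (-1) * Real.exp (a * l) := by
    rw [← Real.exp_add]; ring_nf
  rw [h3] at h2
  rw [Real.exp_neg (a * l), ← div_eq_mul_inv, div_lt_iff₀ (Real.exp_pos _), one_div, mul_assoc,
    lt_inv_mul_iff₀ ha]
  linarith

theorem setOf_isMaxOn_mul_exp_neg {a K : ℝ} (ha : 0 < a) (hK : 0 < K) {f : ℝ → ℝ}
    (hf : ∀ l, 0 < l → f l = l * Real.exp (-(a * l)) * K) :
    {l : ℝ | l ∈ Ioi 0 ∧ IsMaxOn f (Ioi 0) l} = {1 / a} := by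
  have hval : f (1 / a) = 1 / a * Real.exp (-1) * K := by
    rw [hf _ (by positivity), mul_one_div_cancel ha.ne']
  have hlt : ∀ l, 0 < l → l ≠ 1 / a → f l < f (1 / a) := fun l hl hne => by
    rw [hf l hl, hval]
    exact mul_lt_mul_of_pos_right (mul_exp_neg_mul_lt ha hne) hK
  ext l
  constructor
  · rintro ⟨hl, hmax⟩
    by_contra hne
    exact (hlt l hl hne).not_ge (hmax (mem_Ioi.2 (by positivity)))
  · rintro rfl
    refine ⟨mem_Ioi.2 (by positivity), fun l hl => ?_⟩
    by_cases hne : l = 1 / a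
    · simp [hne]
    · exact (hlt l hl hne).le

/-! ### Laplace transforms of the fading gains. -/

/-- The function `t ↦ exp (-t)` on `[0, ∞]`. -/
noncomputable def negExp (t : ℝ≥0∞) : ℝ≥0∞ := EReal.exp (-(t : EReal))

theorem continuous_negExp : Continuous negExp :=
  ENNReal.continuous_exp.comp (continuous_neg.comp continuous_coe_ennreal_ereal)

theorem measurable_negExp : Measurable negExp := continuous_negExp.measurable

theorem antitone_negExp : Antitone negExp := fun _ _ hst =>
  EReal.exp_monotone (EReal.neg_le_neg_iff.2 (EReal.coe_ennreal_le_coe_ennreal_iff.2 hst))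

@[simp] theorem negExp_zero : negExp 0 = 1 := by simp [negExp]

@[simp] theorem negExp_top : negExp ∞ = 0 := by simp [negExp]

theorem negExp_le_one (t : ℝ≥0∞) : negExp t ≤ 1 := by
  rw [← negExp_zero]
  exact antitone_negExp zero_le

theorem negExp_ofReal {x : ℝ} (hx : 0 ≤ x) :
    negExp (ENNReal.ofReal x) = ENNReal.ofReal (Real.exp (-x)) := by
  rw [negExp, EReal.coe_ennreal_ofReal, max_eq_left hx, ← EReal.coe_neg, EReal.exp_coe]

theorem negExp_add (s t : ℝ≥0∞) : negExp (s + t) = negExp s * negExp t := by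
  have hne : ∀ t : ℝ≥0∞, EReal.exp (t : EReal) ≠ 0 := fun t h =>
    EReal.coe_ennreal_ne_bot t (EReal.exp_eq_zero_iff.1 h)
  rw [negExp, negExp, negExp, EReal.exp_neg, EReal.exp_neg, EReal.exp_neg, EReal.coe_ennreal_add,
    EReal.exp_add, ENNReal.mul_inv (Or.inl (hne s)) (Or.inr (hne t))]

theorem negExp_sum {ι : Type*} (s : Finset ι) (f : ι → ℝ≥0∞) :
    negExp (∑ i ∈ s, f i) = ∏ i ∈ s, negExp (f i) := by
  induction s using Finset.cons_induction with
  | empty => simp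
  | cons a s ha ih => rw [Finset.sum_cons, Finset.prod_cons, negExp_add, ih]

/-- Continuity up to ∞ is what allows sums to be handled without first showing that the interference
is finite. -/
theorem tendsto_negExp_sum {ι : Type*} (f : ι → ℝ≥0∞) :
    Tendsto (fun s : Finset ι => negExp (∑ i ∈ s, f i)) atTop (𝓝 (negExp (∑' i, f i))) :=
  (continuous_negExp.tendsto _).comp ENNReal.summable.hasSum

theorem expMeasure_one_setOf_lt_ofReal (t : ℝ≥0∞) :
    expMeasure 1 {y | t < ENNReal.ofReal y} = negExp t := by
  have := isProbabilityMeasure_expMeasure one_pos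
  induction t with
  | top => simp
  | coe t =>
    have hset : {y : ℝ | (t : ℝ≥0∞) < ENNReal.ofReal y} = (Iic (t : ℝ))ᶜ := by
      ext y
      rw [mem_ofPred_eq, ← ENNReal.ofReal_coe_nnreal, compl_Iic, mem_Ioi]
      exact ENNReal.ofReal_lt_ofReal_iff_of_nonneg t.coe_nonneg
    rw [hset, prob_compl_eq_one_sub measurableSet_Iic, ← ofReal_cdf, cdf_expMeasure_eq one_pos,
      if_pos t.coe_nonneg, ← ENNReal.ofReal_one, ← ENNReal.ofReal_sub _ (by simp),
      ← ENNReal.ofReal_coe_nnreal, negExp_ofReal t.coe_nonneg]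
    simp

/-- Tilting the unit exponential density by exp(-wy) gives 1/(1 + w) times the density of rate 1 +
w. The value is written through a logarithm so that products over interferers become sums in the
exponent. -/
theorem lintegral_negExp_mul_expMeasure_one {w : ℝ} (hw : 0 ≤ w) :
    ∫⁻ y, negExp (ENNReal.ofReal (w * y)) ∂expMeasure 1 =
      negExp (ENNReal.ofReal (Real.log (1 + w))) := by
  have hw1 : 0 < 1 + w := by linarith
  have hpt : ∀ y : ℝ, exponentialPDF 1 y * negExp (ENNReal.ofReal (w * y)) =
      ENNReal.ofReal (1 + w)⁻¹ * exponentialPDF (1 + w) y := by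
    intro y
    rcases lt_or_ge y 0 with hy | hy
    · rw [exponentialPDF_of_neg hy, exponentialPDF_of_neg hy, zero_mul, mul_zero]
    · rw [exponentialPDF_of_nonneg hy, exponentialPDF_of_nonneg hy,
        negExp_ofReal (mul_nonneg hw hy), ← ENNReal.ofReal_mul (by positivity),
        ← ENNReal.ofReal_mul (by positivity), one_mul, ← Real.exp_add,
        inv_mul_cancel_left₀ hw1.ne']
      congr 2
      ring
  have hmeas : Measurable (exponentialPDF 1) := (measurable_exponentialPDFReal 1).ennreal_ofReal
  have hdens : expMeasure 1 = volume.withDensity (exponentialPDF 1) := rfl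
  rw [hdens, lintegral_withDensity_eq_lintegral_mul _ hmeas
    (g := fun y => negExp (ENNReal.ofReal (w * y))) (measurable_negExp.comp (by fun_prop))]
  simp only [Pi.mul_apply, hpt]
  rw [lintegral_const_mul _ (f := exponentialPDF (1 + w))
      (measurable_exponentialPDFReal _).ennreal_ofReal,
    lintegral_exponentialPDF_eq_one hw1, mul_one, negExp_ofReal (Real.log_nonneg (by linarith)),
    Real.exp_neg, Real.exp_log hw1]

section Gains

variable {Ω : Type*} [MeasurableSpace Ω] {P : Measure Ω}

theorem lintegral_negExp_tsum_gains {ι : Type*} [Countable ι] {g : ι → Ω → ℝ}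
    (hm : ∀ i, Measurable (g i)) (hlaw : ∀ i, P.map (g i) = expMeasure 1)
    (hind : iIndepFun g P) {w : ι → ℝ} (hw : ∀ i, 0 ≤ w i) :
    ∫⁻ ω, negExp (∑' i, ENNReal.ofReal (w i * g i ω)) ∂P =
      negExp (∑' i, ENNReal.ofReal (Real.log (1 + w i))) := by
  have := hind.isProbabilityMeasure
  have hmw : ∀ i, Measurable fun y : ℝ => negExp (ENNReal.ofReal (w i * y)) := fun i =>
    measurable_negExp.comp (by fun_prop)
  have hfin : ∀ s : Finset ι, ∫⁻ ω, negExp (∑ i ∈ s, ENNReal.ofReal (w i * g i ω)) ∂P =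
      negExp (∑ i ∈ s, ENNReal.ofReal (Real.log (1 + w i))) := by
    intro s
    simp_rw [negExp_sum]
    rw [lintegral_prod_eq_prod_lintegral_of_indepFun s
      (fun i ω => negExp (ENNReal.ofReal (w i * g i ω))) (hind.comp _ hmw)
      (fun i => (hmw i).comp (hm i))]
    refine Finset.prod_congr rfl fun i _ => ?_
    rw [← lintegral_negExp_mul_expMeasure_one (hw i), ← hlaw i, lintegral_map (hmw i) (hm i)]
  have h1 : Tendsto (fun s : Finset ι =>
      ∫⁻ ω, negExp (∑ i ∈ s, ENNReal.ofReal (w i * g i ω)) ∂P) atTop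
      (𝓝 (∫⁻ ω, negExp (∑' i, ENNReal.ofReal (w i * g i ω)) ∂P)) := by
    refine tendsto_lintegral_filter_of_dominated_convergence (fun _ => 1)
      (Eventually.of_forall fun s => measurable_negExp.comp
        (Finset.measurable_sum _ fun i _ => ((hm i).const_mul _).ennreal_ofReal))
      (Eventually.of_forall fun s => Eventually.of_forall fun ω => negExp_le_one _) (by simp)
      (Eventually.of_forall fun ω => tendsto_negExp_sum _)
  simp_rw [hfin] at h1
  exact tendsto_nhds_unique h1 (tendsto_negExp_sum _)

theorem measurable_tsum_gains {ι : Type*} [Countable ι] {g : ι → Ω → ℝ} {w : ι → ℝ}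
    (hm : ∀ i, Measurable (g i)) : Measurable fun ω => ∑' i, ENNReal.ofReal (w i * g i ω) :=
  Measurable.tsum fun i => ((hm i).const_mul _).ennreal_ofReal

theorem indepFun_tsum_gains {g : ℕ → Ω → ℝ} (hm : ∀ i, Measurable (g i)) (hind : iIndepFun g P)
    (w : ℕ → ℝ) (i : ℕ) :
    IndepFun (fun ω => ∑' j : {j : ℕ // j ≠ i}, ENNReal.ofReal (w j * g j ω)) (g i) P := by
  rw [IndepFun_iff_Indep]
  have h := indep_iSup_of_disjoint (fun j => (hm j).comap_le) hind.iIndep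
    (S := {j | j ≠ i}) (T := {i}) (by simp)
  refine indep_of_indep_of_le_right (indep_of_indep_of_le_left h ?_) (by simp)
  refine Measurable.comap_le ?_
  -- The interference must be measurable for the σ-algebra generated by the gains other than `g i`,
  -- not merely for the ambient one.
  exact @measurable_tsum_gains Ω (⨆ k ∈ {j : ℕ | j ≠ i}, MeasurableSpace.comap (g k) inferInstance)
    _ _ (fun j : {j : ℕ // j ≠ i} => g j) (fun j : {j : ℕ // j ≠ i} => w j) fun j =>
      (comap_measurable (g j)).mono (le_iSup₂_of_le j.1 j.2 le_rfl) le_rfl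

/-- Given interference t, the independent serving gain exceeds it with probability exp(-t);
averaging over t leaves the Laplace transform of the interference. -/
theorem measure_tsum_gains_lt {g : ℕ → Ω → ℝ} (hm : ∀ i, Measurable (g i))
    (hlaw : ∀ i, P.map (g i) = expMeasure 1) (hind : iIndepFun g P) {w : ℕ → ℝ}
    (hw : ∀ i, 0 ≤ w i) (i : ℕ) :
    P {ω | ∑' j : {j : ℕ // j ≠ i}, ENNReal.ofReal (w j * g j ω) < ENNReal.ofReal (g i ω)} =
      negExp (∑' j : {j : ℕ // j ≠ i}, ENNReal.ofReal (Real.log (1 + w j))) := by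
  have := hind.isProbabilityMeasure
  have hT : Measurable fun ω => ∑' j : {j : ℕ // j ≠ i}, ENNReal.ofReal (w j * g j ω) :=
    measurable_tsum_gains (w := fun j : {j : ℕ // j ≠ i} => w j) fun j => hm j
  have hprod := (indepFun_tsum_gains hm hind w i).map_prod_eq_prod_map_map hT.aemeasurable
    (hm i).aemeasurable
  have hS : MeasurableSet {p : ℝ≥0∞ × ℝ | p.1 < ENNReal.ofReal p.2} :=
    measurableSet_lt measurable_fst measurable_snd.ennreal_ofReal
  have h1 := congrArg (fun m : Measure (ℝ≥0∞ × ℝ) => m {p | p.1 < ENNReal.ofReal p.2}) hprod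
  rw [Measure.map_apply (hT.prodMk (hm i)) hS, hlaw i] at h1
  have := isProbabilityMeasure_expMeasure one_pos
  rw [Measure.prod_apply hS] at h1
  refine h1.trans ?_
  have h2 : ∀ t : ℝ≥0∞, expMeasure 1 (Prod.mk t ⁻¹' {p : ℝ≥0∞ × ℝ | p.1 < ENNReal.ofReal p.2}) =
      negExp t := expMeasure_one_setOf_lt_ofReal
  simp_rw [h2]
  rw [lintegral_map measurable_negExp hT]
  exact lintegral_negExp_tsum_gains (fun j => hm _) (fun j => hlaw _)
    (hind.precomp (g := fun j : {j : ℕ // j ≠ i} => (j : ℕ)) Subtype.val_injective)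
    (w := fun j : {j : ℕ // j ≠ i} => w j) (fun j => hw _)

theorem pathloss_pos {α h : ℝ} (hh : 0 < h) (r : ℝ) : 0 < pathloss α h r := by
  unfold pathloss
  positivity

end Gains

theorem lt_sir_iff {Ω : Type*} {α h θ : ℝ} (hh : 0 < h) (x : ℕ → Ω → EuclideanSpace ℝ (Fin 2))
    (g : ℕ → Ω → ℝ) (i : ℕ) (ω : Ω) (hθ : 0 < θ) :
    ENNReal.ofReal θ < sir α h x g i ω ↔
      ∑' j : {j : ℕ // j ≠ i}, ENNReal.ofReal
        (θ * (pathloss α h ‖x j ω‖ / pathloss α h ‖x i ω‖) * g j ω) < ENNReal.ofReal (g i ω) := by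
  have hl := pathloss_pos (α := α) hh ‖x i ω‖
  have hl0 : ENNReal.ofReal (pathloss α h ‖x i ω‖) ≠ 0 := by simpa using hl
  unfold sir
  rw [ENNReal.lt_div_iff_mul_lt (Or.inr ENNReal.ofReal_ne_top)
    (Or.inr (by simpa using hθ)), ← ENNReal.tsum_mul_left, mul_comm (g i ω),
    ENNReal.ofReal_mul hl.le]
  have : ∀ j : {j : ℕ // j ≠ i}, ENNReal.ofReal θ * ENNReal.ofReal (g j ω * pathloss α h ‖x j ω‖) =
      ENNReal.ofReal (pathloss α h ‖x i ω‖) * ENNReal.ofReal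
        (θ * (pathloss α h ‖x j ω‖ / pathloss α h ‖x i ω‖) * g j ω) := fun j => by
    rw [← ENNReal.ofReal_mul hθ.le, ← ENNReal.ofReal_mul hl.le]
    congr 1
    field_simp
  simp_rw [this]
  rw [ENNReal.tsum_mul_left, ENNReal.mul_lt_mul_iff_right hl0 ENNReal.ofReal_ne_top]

/-! ### Equal-area annuli and their Poisson counts. -/

/-- The annuli around the origin of equal area `π * ε`. -/
def annulus (ε : ℝ) (m : ℕ) : Set (EuclideanSpace ℝ (Fin 2)) := {y | ⌊‖y‖ ^ 2 / ε⌋₊ = m}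

theorem mem_annulus_iff {ε : ℝ} (hε : 0 < ε) {m : ℕ} {y : EuclideanSpace ℝ (Fin 2)} :
    y ∈ annulus ε m ↔ m * ε ≤ ‖y‖ ^ 2 ∧ ‖y‖ ^ 2 < (m + 1) * ε := by
  rw [annulus, mem_ofPred_eq, Nat.floor_eq_iff (by positivity), le_div_iff₀ hε, div_lt_iff₀ hε]

theorem measurableSet_annulus (ε : ℝ) (m : ℕ) : MeasurableSet (annulus ε m) := by
  have : Measurable fun y : EuclideanSpace ℝ (Fin 2) => ⌊‖y‖ ^ 2 / ε⌋₊ :=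
    Nat.measurable_floor.comp (by fun_prop)
  exact this (measurableSet_singleton m)

theorem pairwise_disjoint_annulus (ε : ℝ) {n : ℕ} :
    Pairwise (Function.onFun Disjoint fun m : Fin n => annulus ε m) := by
  intro i j hij
  rw [Function.onFun, disjoint_left]
  intro y hi hj
  exact hij (Fin.ext (hi.symm.trans hj))

theorem annulus_eq_diff {ε : ℝ} (hε : 0 < ε) (m : ℕ) :
    annulus ε m = Metric.ball 0 (√((m + 1) * ε)) \ Metric.ball 0 (√(m * ε)) := by
  ext y
  rw [mem_annulus_iff hε, Set.mem_sdiff, mem_ball_zero_iff, mem_ball_zero_iff, not_lt,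
    Real.lt_sqrt (norm_nonneg y), Real.sqrt_le_left (norm_nonneg y), and_comm]

theorem isBounded_annulus {ε : ℝ} (hε : 0 < ε) (m : ℕ) : Bornology.IsBounded (annulus ε m) := by
  rw [annulus_eq_diff hε]
  exact Metric.isBounded_ball.subset sdiff_subset

theorem volume_annulus {ε : ℝ} (hε : 0 < ε) (m : ℕ) :
    (volume (annulus ε m)).toReal = Real.pi * ε := by
  have hle : √(m * ε) ≤ √((m + 1) * ε) := Real.sqrt_le_sqrt (by nlinarith)
  rw [annulus_eq_diff hε, measure_sdiff (Metric.ball_subset_ball hle)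
    measurableSet_ball.nullMeasurableSet (by simp [ENNReal.mul_eq_top]),
    ENNReal.toReal_sub_of_le (measure_mono (Metric.ball_subset_ball hle))
      (by simp [ENNReal.mul_eq_top])]
  rw [EuclideanSpace.volume_ball_fin_two, EuclideanSpace.volume_ball_fin_two]
  simp only [ENNReal.toReal_mul, ENNReal.toReal_pow]
  rw [ENNReal.toReal_ofReal (by positivity), ENNReal.toReal_ofReal (by positivity),
    ENNReal.toReal_ofReal (by positivity), Real.sq_sqrt (by positivity),
    Real.sq_sqrt (by positivity)]
  ring

/-- The number of points of the sequence `x` in the `m`-th annulus. -/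
noncomputable def annulusCount (ε : ℝ) (x : ℕ → EuclideanSpace ℝ (Fin 2)) (m : ℕ) : ℕ∞ :=
  {i : ℕ | x i ∈ annulus ε m}.encard

theorem annulusCount_eq_tsum (ε : ℝ) (x : ℕ → EuclideanSpace ℝ (Fin 2)) (m : ℕ) :
    (annulusCount ε x m : ℝ≥0∞) = ∑' i, {i : ℕ | x i ∈ annulus ε m}.indicator 1 i := by
  rw [annulusCount, ← ENNReal.tsum_set_one]
  exact tsum_subtype {i : ℕ | x i ∈ annulus ε m} 1

section Counts

variable {Ω : Type*} [MeasurableSpace Ω] {P : Measure Ω} {lam : ℝ}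
  {x : ℕ → Ω → EuclideanSpace ℝ (Fin 2)}

theorem measurable_annulusCount (hx : ∀ i, Measurable (x i)) (ε : ℝ) (m : ℕ) :
    Measurable fun ω => annulusCount ε (fun i => x i ω) m := by
  have h1 : Measurable fun ω => (annulusCount ε (fun i => x i ω) m : ℝ≥0∞) := by
    simp_rw [annulusCount_eq_tsum]
    refine Measurable.tsum fun i => ?_
    exact (measurable_const (a := (1 : ℝ≥0∞))).indicator (hx i (measurableSet_annulus ε m))
  refine ENat.measurable_iff.2 fun n => ?_
  have h2 := h1 (measurableSet_singleton (n : ℝ≥0∞))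
  convert! h2 using 1
  ext ω
  simp only [mem_preimage, mem_singleton_iff]
  norm_cast

theorem IsPoissonPointProcess.map_annulusCount [IsProbabilityMeasure P]
    (h : IsPoissonPointProcess lam x P) {ε : ℝ} (hε : 0 < ε) (n : ℕ) :
    P.map (fun ω (m : Fin n) => annulusCount ε (fun i => x i ω) m) =
      Measure.pi fun _ => (poissonMeasure (lam * (Real.pi * ε)).toNNReal).map
        (Nat.cast : ℕ → ℕ∞) := by
  have hmeas : Measurable fun ω (m : Fin n) => annulusCount ε (fun i => x i ω) m :=
    measurable_pi_lambda _ fun m => measurable_annulusCount h.measurable ε m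
  have hcast : Measurable (Nat.cast : ℕ → ℕ∞) := measurable_of_countable _
  have := Measure.isProbabilityMeasure_map hmeas.aemeasurable (μ := P)
  have := Measure.isProbabilityMeasure_map hcast.aemeasurable
    (μ := poissonMeasure (lam * (Real.pi * ε)).toNNReal)
  -- Between probability measures one inequality suffices. It is checked on atoms: those with an
  -- infinite coordinate are null for the product measure, so the law of the counts need not be
  -- evaluated there.
  refine (Measure.eq_of_le_of_isProbabilityMeasure (Measure.le_iff.2 fun s hs => ?_)).symm
  rw [← Measure.tsum_indicator_apply_singleton _ s hs,
    ← Measure.tsum_indicator_apply_singleton _ s hs]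
  refine ENNReal.tsum_le_tsum fun k => indicator_le_indicator ?_
  by_cases hk : ∃ k' : Fin n → ℕ, (fun j => (k' j : ℕ∞)) = k
  · obtain ⟨k', rfl⟩ := hk
    have hlaw := h.law n (fun m => annulus ε m) (fun m => measurableSet_annulus ε m)
      (fun m => isBounded_annulus hε m) (pairwise_disjoint_annulus ε) k'
    rw [Measure.map_apply hmeas (measurableSet_singleton _), Measure.pi_singleton]
    refine le_of_eq ?_
    have hset : (fun ω (m : Fin n) => annulusCount ε (fun i => x i ω) m) ⁻¹'
        {fun j => (k' j : ℕ∞)} = {ω | ∀ j : Fin n, {i | x i ω ∈ annulus ε j}.encard = k' j} := by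
      ext ω
      simp [funext_iff, annulusCount]
    rw [hset, hlaw]
    refine Finset.prod_congr rfl fun j _ => ?_
    rw [volume_annulus hε, Measure.map_apply hcast (measurableSet_singleton _)]
    congr 1
    ext i
    simp
  · have : ∃ j, k j = ⊤ := by
      by_contra! hne
      exact hk ⟨fun j => (k j).toNat, funext fun j => ENat.natCast_toNat (hne j)⟩
    obtain ⟨j, hj⟩ := this
    rw [Measure.pi_singleton, Finset.prod_eq_zero (Finset.mem_univ j)]
    · exact zero_le
    · rw [hj, Measure.map_apply hcast (measurableSet_singleton _)]
      have : (Nat.cast : ℕ → ℕ∞) ⁻¹' {⊤} = ∅ := by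
        ext i
        simp
      rw [this, measure_empty]

theorem IsPoissonPointProcess.lintegral_prod_annulusCount [IsProbabilityMeasure P]
    (h : IsPoissonPointProcess lam x P) {ε : ℝ} (hε : 0 < ε) (n : ℕ) (f : ℕ → ℕ∞ → ℝ≥0∞) :
    ∫⁻ ω, ∏ m ∈ Finset.range n, f m (annulusCount ε (fun i => x i ω) m) ∂P =
      ∏ m ∈ Finset.range n,
        ∫⁻ k : ℕ, f m k ∂poissonMeasure (lam * (Real.pi * ε)).toNNReal := by
  have hmeas : Measurable fun ω (m : Fin n) => annulusCount ε (fun i => x i ω) m :=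
    measurable_pi_lambda _ fun m => measurable_annulusCount h.measurable ε m
  have hcast : Measurable (Nat.cast : ℕ → ℕ∞) := measurable_of_countable _
  have := Measure.isProbabilityMeasure_map hcast.aemeasurable
    (μ := poissonMeasure (lam * (Real.pi * ε)).toNNReal)
  have hf : ∀ m, Measurable (f m) := fun m => measurable_of_countable _
  rw [Finset.prod_range]
  simp_rw [Finset.prod_range]
  have h1 := lintegral_map (μ := P) (f := fun k : Fin n → ℕ∞ => ∏ m : Fin n, f m (k m))
    (Finset.measurable_prod _ fun m _ => (hf m).comp (measurable_pi_apply m)) hmeas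
  rw [← h1, h.map_annulusCount hε, lintegral_prod_eq_prod_lintegral_of_indepFun _
    (fun (m : Fin n) (k : Fin n → ℕ∞) => f m (k m))
    (iIndepFun_pi fun m => (hf m).aemeasurable) fun m => (hf m).comp (measurable_pi_apply m)]
  refine Finset.prod_congr rfl fun m _ => ?_
  rw [(measurePreserving_eval _ m).lintegral_comp (hf m), lintegral_map (hf m) hcast]

end Counts

section PoissonMeasure

variable (r : ℝ≥0)

theorem lintegral_poissonMeasure (f : ℕ → ℝ≥0∞) :
    ∫⁻ k, f k ∂poissonMeasure r =
      ∑' k, f k * ENNReal.ofReal (Real.exp (-r) * r ^ k / k.factorial) := by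
  simp_rw [lintegral_countable', poissonMeasure_singleton]

theorem lintegral_poissonMeasure_indicator_singleton (n : ℕ) :
    ∫⁻ k : ℕ, ({(n : ℕ∞)} : Set ℕ∞).indicator 1 (k : ℕ∞) ∂poissonMeasure r =
      ENNReal.ofReal (Real.exp (-r) * r ^ n / n.factorial) := by
  rw [lintegral_poissonMeasure, tsum_eq_single n]
  · simp
  · intro k hk
    rw [indicator_of_notMem (by simpa using hk), zero_mul]

theorem lintegral_poissonMeasure_negExp {l : ℝ} (hl : 0 ≤ l) :
    ∫⁻ k : ℕ, negExp (ENNReal.ofReal l * ((k : ℕ∞) : ℝ≥0∞)) ∂poissonMeasure r =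
      ENNReal.ofReal (Real.exp (-(r * (1 - Real.exp (-l))))) := by
  rw [lintegral_poissonMeasure]
  have hterm : ∀ k : ℕ, negExp (ENNReal.ofReal l * ((k : ℕ∞) : ℝ≥0∞)) *
      ENNReal.ofReal (Real.exp (-r) * r ^ k / k.factorial) =
      ENNReal.ofReal (Real.exp (-r) * ((r * Real.exp (-l)) ^ k / k.factorial)) := fun k => by
    rw [ENat.toENNReal_coe, ← ENNReal.ofReal_natCast, ← ENNReal.ofReal_mul hl,
      negExp_ofReal (by positivity), ← ENNReal.ofReal_mul (by positivity)]
    congr 1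
    rw [mul_pow, ← Real.exp_nat_mul]
    ring_nf
  have hs : HasSum (fun k : ℕ => (r * Real.exp (-l)) ^ k / k.factorial)
      (Real.exp (r * Real.exp (-l))) := by
    rw [Real.exp_eq_exp_ℝ]
    exact NormedSpace.expSeries_div_hasSum_exp _
  simp_rw [hterm]
  rw [← ENNReal.ofReal_tsum_of_nonneg (fun k => by positivity) (hs.mul_left _).summable,
    (hs.mul_left _).tsum_eq, ← Real.exp_add]
  ring_nf

end PoissonMeasure

/-! ### The first occupied annulus holding a single point. -/

section FirstAnnulus

/-- The sequence `x` has exactly one point in the `k`-th annulus and none closer to the origin. -/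
def IsFirstAnnulus (ε : ℝ) (x : ℕ → EuclideanSpace ℝ (Fin 2)) (k : ℕ) : Prop :=
  (∀ m < k, annulusCount ε x m = 0) ∧ annulusCount ε x k = 1

variable {Ω : Type*} [MeasurableSpace Ω] {P : Measure Ω} {lam : ℝ}
  {x : ℕ → Ω → EuclideanSpace ℝ (Fin 2)}

theorem measurableSet_isFirstAnnulus (hx : ∀ i, Measurable (x i)) (ε : ℝ) (k : ℕ) :
    MeasurableSet {ω | IsFirstAnnulus ε (fun i => x i ω) k} := by
  have h : ∀ m (c : ℕ∞), MeasurableSet {ω | annulusCount ε (fun i => x i ω) m = c} := fun m c =>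
    measurable_annulusCount hx ε m (measurableSet_singleton c)
  simp only [IsFirstAnnulus, ofPred_and, ofPred_forall]
  exact (MeasurableSet.iInter fun m => MeasurableSet.iInter fun _ => h m 0).inter (h k 1)

theorem IsPoissonPointProcess.setLIntegral_negExp_sum [IsProbabilityMeasure P]
    (h : IsPoissonPointProcess lam x P) (hlam : 0 < lam) {ε : ℝ} (hε : 0 < ε) (k n : ℕ)
    {l : ℕ → ℝ} (hl : ∀ i, 0 ≤ l i) :
    ∫⁻ ω in {ω | IsFirstAnnulus ε (fun i => x i ω) k},
        negExp (∑ i ∈ Finset.range n,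
          ENNReal.ofReal (l i) * annulusCount ε (fun i => x i ω) (k + 1 + i)) ∂P =
      ENNReal.ofReal (lam * (Real.pi * ε) * Real.exp (-(lam * (Real.pi * ε) * (k + 1))) *
        Real.exp (-(lam * (Real.pi * ε) *
          ∑ i ∈ Finset.range n, (1 - Real.exp (-l i))))) := by
  set r := lam * (Real.pi * ε) with hr
  have hr0 : 0 < r := by positivity
  have hrr : (r.toNNReal : ℝ) = r := Real.coe_toNNReal _ hr0.le
  -- The indicator of the event also factors over annuli (count 0 inside, count 1 at k), so the
  -- whole integrand is a product of functions of independent counts.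
  let f : ℕ → ℕ∞ → ℝ≥0∞ := fun m c =>
    if m < k then ({0} : Set ℕ∞).indicator 1 c
    else if m = k then ({1} : Set ℕ∞).indicator 1 c
    else negExp (ENNReal.ofReal (l (m - (k + 1))) * c)
  have hf0 : ∀ m < k, f m = ({((0 : ℕ) : ℕ∞)} : Set ℕ∞).indicator 1 := fun m hm => by
    ext c; simp [f, hm]
  have hf1 : f k = ({((1 : ℕ) : ℕ∞)} : Set ℕ∞).indicator 1 := by ext c; simp [f]
  have hf2 : ∀ i c, f (k + 1 + i) c = negExp (ENNReal.ofReal (l i) * c) := fun i c => by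
    simp only [f]
    rw [if_neg (by omega), if_neg (by omega)]
    simp
  have hkey := h.lintegral_prod_annulusCount hε (k + 1 + n) f
  rw [← lintegral_indicator (measurableSet_isFirstAnnulus h.measurable ε k)]
  have hpt : ∀ ω, ∏ m ∈ Finset.range (k + 1 + n), f m (annulusCount ε (fun i => x i ω) m) =
      {ω | IsFirstAnnulus ε (fun i => x i ω) k}.indicator (fun ω =>
        negExp (∑ i ∈ Finset.range n,
          ENNReal.ofReal (l i) * annulusCount ε (fun i => x i ω) (k + 1 + i))) ω := by
    intro ω
    rw [Finset.prod_range_add, Finset.prod_range_succ]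
    simp_rw [hf2, negExp_sum]
    by_cases hω : IsFirstAnnulus ε (fun i => x i ω) k
    · rw [indicator_of_mem (by exact hω), hf1, Finset.prod_eq_one, hω.2]
      · simp
      · intro m hm
        rw [hf0 m (Finset.mem_range.1 hm), hω.1 m (Finset.mem_range.1 hm)]
        simp
    · rw [indicator_of_notMem (by exact hω)]
      by_cases h1 : annulusCount ε (fun i => x i ω) k = 1
      · have : ∃ m < k, annulusCount ε (fun i => x i ω) m ≠ 0 := by
          by_contra! hne
          exact hω ⟨hne, h1⟩
        obtain ⟨m, hm, hne⟩ := this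
        rw [Finset.prod_eq_zero (Finset.mem_range.2 hm), zero_mul, zero_mul]
        rw [hf0 m hm, indicator_of_notMem (by simpa using hne)]
      · rw [hf1, indicator_of_notMem (by simpa using h1), mul_zero, zero_mul]
  simp_rw [hpt] at hkey
  rw [hkey, Finset.prod_range_add, Finset.prod_range_succ]
  have e0 : ∀ m ∈ Finset.range k, ∫⁻ c : ℕ, f m c ∂poissonMeasure r.toNNReal =
      ENNReal.ofReal (Real.exp (-r)) := fun m hm => by
    rw [hf0 m (Finset.mem_range.1 hm), lintegral_poissonMeasure_indicator_singleton, hrr]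
    simp
  have e1 : ∫⁻ c : ℕ, f k c ∂poissonMeasure r.toNNReal = ENNReal.ofReal (r * Real.exp (-r)) := by
    rw [hf1, lintegral_poissonMeasure_indicator_singleton, hrr]
    simp [mul_comm]
  have e2 : ∀ i ∈ Finset.range n, ∫⁻ c : ℕ, f (k + 1 + i) c ∂poissonMeasure r.toNNReal =
      ENNReal.ofReal (Real.exp (-(r * (1 - Real.exp (-l i))))) := fun i _ => by
    simp_rw [hf2]
    rw [lintegral_poissonMeasure_negExp _ (hl i), hrr]
  rw [Finset.prod_congr rfl e0, e1, Finset.prod_congr rfl e2, Finset.prod_const, Finset.card_range,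
    ← ENNReal.ofReal_pow (by positivity), ← ENNReal.ofReal_prod_of_nonneg (fun i _ => by positivity),
    ← Real.exp_sum, ← ENNReal.ofReal_mul (by positivity), ← ENNReal.ofReal_mul (by positivity),
    Finset.mul_sum, Finset.sum_neg_distrib, ← Real.exp_nat_mul]
  congr 2
  have : -(r * ((k : ℝ) + 1)) = k * -r + -r := by ring
  rw [this, Real.exp_add]
  ring

theorem IsPoissonPointProcess.setLIntegral_negExp_tsum [IsProbabilityMeasure P]
    (h : IsPoissonPointProcess lam x P) (hlam : 0 < lam) {ε : ℝ} (hε : 0 < ε) (k : ℕ)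
    {l : ℕ → ℝ} (hl : ∀ i, 0 ≤ l i) (hs : Summable fun i => 1 - Real.exp (-l i)) :
    ∫⁻ ω in {ω | IsFirstAnnulus ε (fun i => x i ω) k},
        negExp (∑' i, ENNReal.ofReal (l i) * annulusCount ε (fun i => x i ω) (k + 1 + i)) ∂P =
      ENNReal.ofReal (lam * (Real.pi * ε) * Real.exp (-(lam * (Real.pi * ε) * (k + 1))) *
        Real.exp (-(lam * (Real.pi * ε) * ∑' i, (1 - Real.exp (-l i))))) := by
  have hm : ∀ m, Measurable fun ω => (annulusCount ε (fun i => x i ω) m : ℝ≥0∞) := fun m =>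
    (measurable_of_countable (fun c : ℕ∞ => (c : ℝ≥0∞))).comp
      (measurable_annulusCount h.measurable ε m)
  refine tendsto_nhds_unique (f := fun n : ℕ =>
    ∫⁻ ω in {ω | IsFirstAnnulus ε (fun i => x i ω) k},
        negExp (∑ i ∈ Finset.range n,
          ENNReal.ofReal (l i) * annulusCount ε (fun i => x i ω) (k + 1 + i)) ∂P) (l := atTop) ?_ ?_
  · refine tendsto_lintegral_of_dominated_convergence (fun _ => 1) (fun n => ?_)
      (fun n => Eventually.of_forall fun ω => negExp_le_one _) (by simp)
      (Eventually.of_forall fun ω => ?_)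
    · exact measurable_negExp.comp (Finset.measurable_sum _ fun i _ => (hm _).const_mul _)
    · exact (continuous_negExp.tendsto _).comp (ENNReal.tendsto_nat_tsum _)
  · simp_rw [h.setLIntegral_negExp_sum hlam hε k _ hl]
    refine (ENNReal.continuous_ofReal.tendsto _).comp (Tendsto.const_mul _ ?_)
    exact (Real.continuous_exp.tendsto _).comp (hs.hasSum.tendsto_sum_nat.const_mul _).neg

end FirstAnnulus

section FirstAnnulus

variable {ε : ℝ} {x : ℕ → EuclideanSpace ℝ (Fin 2)} {k : ℕ}

theorem IsFirstAnnulus.exists_index (hx : IsFirstAnnulus ε x k) :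
    ∃ i, x i ∈ annulus ε k ∧ ∀ j ≠ i, k + 1 ≤ ⌊‖x j‖ ^ 2 / ε⌋₊ := by
  obtain ⟨i, hi⟩ := encard_eq_one.1 hx.2
  refine ⟨i, (Set.ext_iff.1 hi i).2 rfl, fun j hj => ?_⟩
  rcases lt_trichotomy ⌊‖x j‖ ^ 2 / ε⌋₊ k with h | h | h
  · have : j ∈ ({l | x l ∈ annulus ε ⌊‖x j‖ ^ 2 / ε⌋₊} : Set ℕ) := rfl
    rw [encard_eq_zero.1 (hx.1 _ h)] at this
    exact this.elim
  · exact (hj ((Set.ext_iff.1 hi j).1 h)).elim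
  · exact h

/-- Exchange the sums over annuli and points: each point other than the server lies in exactly one
annulus beyond the k-th, and the server in none of them. -/
theorem tsum_mul_annulusCount {i : ℕ} (hi : x i ∈ annulus ε k)
    (hj : ∀ j ≠ i, k + 1 ≤ ⌊‖x j‖ ^ 2 / ε⌋₊) (c : ℕ → ℝ≥0∞) :
    ∑' n, c n * annulusCount ε x (k + 1 + n) =
      ∑' j : {j : ℕ // j ≠ i}, c (⌊‖x j‖ ^ 2 / ε⌋₊ - (k + 1)) := by
  simp_rw [annulusCount_eq_tsum, ← ENNReal.tsum_mul_left]
  rw [ENNReal.tsum_comm, ← tsum_subtype_eq_of_support_subset (s := {j | j ≠ i})]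
  · refine tsum_congr fun j => ?_
    have h := hj j j.2
    rw [tsum_eq_single (⌊‖x j‖ ^ 2 / ε⌋₊ - (k + 1))]
    · rw [indicator_of_mem, Pi.one_apply, mul_one]
      change ⌊‖x j‖ ^ 2 / ε⌋₊ = _
      omega
    · intro n hn
      rw [indicator_of_notMem, mul_zero]
      intro (hmem : ⌊‖x j‖ ^ 2 / ε⌋₊ = k + 1 + n)
      omega
  · intro j hne hji
    refine hne (ENNReal.tsum_eq_zero.2 fun n => ?_)
    rw [indicator_of_notMem, mul_zero]
    intro (hmem : ⌊‖x j‖ ^ 2 / ε⌋₊ = k + 1 + n)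
    have hi' : ⌊‖x i‖ ^ 2 / ε⌋₊ = k := hi
    rw [hji] at hmem
    omega

end FirstAnnulus

/-- This is why the Poisson Laplace exponent becomes a Riemann sum of the kernel. -/
theorem one_sub_exp_neg_log_one_add {b θ u : ℝ} (hθ : 0 < θ) (hu : 0 < u) :
    1 - Real.exp (-Real.log (1 + θ * u ^ (-b))) = interferenceKernel b θ u := by
  have : 0 < u ^ (-b) := by positivity
  rw [Real.exp_neg, Real.exp_log (by positivity), interferenceKernel]
  field_simp
  ring

theorem pairwise_disjoint_isFirstAnnulus {Ω : Type*} (x : ℕ → Ω → EuclideanSpace ℝ (Fin 2)) (ε : ℝ) :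
    Pairwise (Function.onFun Disjoint fun k => {ω | IsFirstAnnulus ε (fun i => x i ω) k}) := by
  have key : ∀ k k' : ℕ, k < k' → Disjoint {ω | IsFirstAnnulus ε (fun i => x i ω) k}
      {ω | IsFirstAnnulus ε (fun i => x i ω) k'} := fun k k' hk => by
    rw [disjoint_left]
    intro ω h1 h2
    exact zero_ne_one ((h2.1 k hk).symm.trans h1.2)
  intro k k' hne
  rcases lt_or_gt_of_ne hne with h | h
  · exact key k k' h
  · exact (key k' k h).symm

theorem tsum_ofReal_mul_geometric {c q : ℝ} (hc : 0 ≤ c) (h0 : 0 ≤ q) (h1 : q < 1) :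
    ∑' k : ℕ, ENNReal.ofReal (c * q ^ k) = ENNReal.ofReal (c / (1 - q)) := by
  rw [← ENNReal.ofReal_tsum_of_nonneg (fun k => by positivity)
    ((summable_geometric_of_lt_one h0 h1).mul_left c), tsum_mul_left,
    tsum_geometric_of_lt_one h0 h1, div_eq_mul_inv]

/-! ### Coverage given the locations, and two-sided bounds. -/

section Coverage

variable {Ω : Type*} [MeasurableSpace Ω] {P : Measure Ω} {α h θ lam : ℝ}

/-- The event that the closest base station covers the origin, when the base stations have the
deterministic locations `y`. -/
def coverageEvent (α h θ : ℝ) (y : ℕ → EuclideanSpace ℝ (Fin 2)) (g : ℕ → Ω → ℝ) : Set Ω :=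
  {ω | ∃ i, (∀ j, ‖y i‖ ≤ ‖y j‖) ∧ ENNReal.ofReal θ < sir α h (fun i _ => y i) g i ω}

theorem measurableSet_coverage (α h θ : ℝ) :
    MeasurableSet {p : (ℕ → EuclideanSpace ℝ (Fin 2)) × (ℕ → ℝ) |
      ∃ i, (∀ j, ‖p.1 i‖ ≤ ‖p.1 j‖) ∧
        ENNReal.ofReal θ < sir α h (fun i p => p.1 i) (fun i p => p.2 i) i p} := by
  have hy : ∀ i, Measurable fun p : (ℕ → EuclideanSpace ℝ (Fin 2)) × (ℕ → ℝ) => p.1 i :=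
    fun i => (measurable_pi_apply i).comp measurable_fst
  have hterm : ∀ i, Measurable fun p : (ℕ → EuclideanSpace ℝ (Fin 2)) × (ℕ → ℝ) =>
      ENNReal.ofReal (p.2 i * pathloss α h ‖p.1 i‖) := fun i => by
    have h1 : Measurable fun p : (ℕ → EuclideanSpace ℝ (Fin 2)) × (ℕ → ℝ) => p.2 i :=
      (measurable_pi_apply i).comp measurable_snd
    have h2 : Measurable (pathloss α h) := by unfold pathloss; fun_prop
    exact (h1.mul (h2.comp (hy i).norm)).ennreal_ofReal
  simp only [ofPred_exists, ofPred_and, ofPred_forall]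
  refine MeasurableSet.iUnion fun i => MeasurableSet.inter
    (MeasurableSet.iInter fun j => measurableSet_le (hy i).norm (hy j).norm) ?_
  refine measurableSet_lt measurable_const ?_
  exact (hterm i).div (Measurable.tsum fun j => hterm j)

/-- Independence of locations and gains makes their joint law a product, so Tonelli allows the
locations to be frozen while the gains are averaged. -/
theorem IsRayleighNetwork.measure_coverage [IsProbabilityMeasure P]
    {x : ℕ → Ω → EuclideanSpace ℝ (Fin 2)} {g : ℕ → Ω → ℝ} (hN : IsRayleighNetwork lam x g P)
    (α h θ : ℝ) :
    P {ω | ∃ i, (∀ j, ‖x i ω‖ ≤ ‖x j ω‖) ∧ ENNReal.ofReal θ < sir α h x g i ω} =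
      ∫⁻ ω, P (coverageEvent α h θ (fun i => x i ω) g) ∂P := by
  have hX : Measurable fun ω i => x i ω := measurable_pi_lambda _ hN.poisson.measurable
  have hG : Measurable fun ω i => g i ω := measurable_pi_lambda _ hN.measurable_gain
  have hS := measurableSet_coverage α h θ
  have hprod := hN.indep.map_prod_eq_prod_map_map hX.aemeasurable hG.aemeasurable
  have h1 := congrArg (fun m => m {p : (ℕ → EuclideanSpace ℝ (Fin 2)) × (ℕ → ℝ) |
      ∃ i, (∀ j, ‖p.1 i‖ ≤ ‖p.1 j‖) ∧
        ENNReal.ofReal θ < sir α h (fun i p => p.1 i) (fun i p => p.2 i) i p}) hprod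
  rw [Measure.map_apply (hX.prodMk hG) hS, Measure.prod_apply hS,
    lintegral_map (measurable_measure_prodMk_left hS) hX] at h1
  refine h1.trans (lintegral_congr fun ω => ?_)
  rw [Measure.map_apply hG (measurable_prodMk_left hS)]
  rfl

theorem measure_coverageEvent_of_closest (hh : 0 < h) (hθ : 0 < θ) {g : ℕ → Ω → ℝ}
    (hm : ∀ i, Measurable (g i)) (hlaw : ∀ i, P.map (g i) = expMeasure 1) (hind : iIndepFun g P)
    {y : ℕ → EuclideanSpace ℝ (Fin 2)} {i : ℕ} (hi : ∀ j ≠ i, ‖y i‖ < ‖y j‖) :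
    P (coverageEvent α h θ y g) = negExp (∑' j : {j : ℕ // j ≠ i},
      ENNReal.ofReal (Real.log (1 + θ * (pathloss α h ‖y j‖ / pathloss α h ‖y i‖)))) := by
  have hev : coverageEvent α h θ y g = {ω | ∑' j : {j : ℕ // j ≠ i}, ENNReal.ofReal
      (θ * (pathloss α h ‖y j‖ / pathloss α h ‖y i‖) * g j ω) < ENNReal.ofReal (g i ω)} := by
    ext ω
    rw [mem_ofPred_eq, ← lt_sir_iff hh (fun i _ => y i) g i ω hθ]
    constructor
    · rintro ⟨i', hi', hlt⟩
      have : i' = i := by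
        by_contra hne
        exact (hi i' hne).not_ge (hi' i)
      rwa [this] at hlt
    · intro hlt
      refine ⟨i, fun j => ?_, hlt⟩
      by_cases hj : j = i
      · rw [hj]
      · exact (hi j hj).le
  rw [hev]
  exact measure_tsum_gains_lt hm hlaw hind
    (w := fun j => θ * (pathloss α h ‖y j‖ / pathloss α h ‖y i‖))
    (fun j => mul_nonneg hθ.le (div_nonneg (pathloss_pos hh _).le (pathloss_pos hh _).le)) i

theorem pathloss_div_pathloss (hh : 0 < h) (r s : ℝ) :
    pathloss α h s / pathloss α h r = ((s ^ 2 + h ^ 2) / (r ^ 2 + h ^ 2)) ^ (-(α / 2)) := by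
  unfold pathloss
  rw [Real.div_rpow (by positivity) (by positivity)]

theorem log_one_add_mul_rpow_neg_le {b u v : ℝ} (hb : 0 < b) (hθ : 0 < θ) (hu : 0 < u)
    (huv : u ≤ v) : Real.log (1 + θ * v ^ (-b)) ≤ Real.log (1 + θ * u ^ (-b)) := by
  have hv : 0 < v := hu.trans_le huv
  have h1 : 0 < v ^ (-b) := by positivity
  have h2 : v ^ (-b) ≤ u ^ (-b) := Real.rpow_le_rpow_of_nonpos hu huv (by linarith)
  refine Real.log_le_log (by positivity) ?_
  gcongr

theorem norm_lt_of_first_annulus {ε : ℝ} (hε : 0 < ε) {y z : EuclideanSpace ℝ (Fin 2)} {k : ℕ}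
    (hy : y ∈ annulus ε k) (hz : k + 1 ≤ ⌊‖z‖ ^ 2 / ε⌋₊) : ‖y‖ < ‖z‖ := by
  have h1 := ((mem_annulus_iff hε).1 hy).2
  have h2 := ((mem_annulus_iff hε).1 (show z ∈ annulus ε ⌊‖z‖ ^ 2 / ε⌋₊ from rfl)).1
  have h3 : ((k : ℝ) + 1) ≤ (⌊‖z‖ ^ 2 / ε⌋₊ : ℝ) := by exact_mod_cast hz
  refine lt_of_pow_lt_pow_left₀ 2 (norm_nonneg z) ?_
  nlinarith

/-- With the server in annulus k and an interferer in annulus k + 1 + n, the smallest ratio pairs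
the outer edge k + 1 with the inner edge k + 1 + n, a gap of n. The largest pairs the inner edge k
with the outer edge k + n + 2, a gap of n + 2. -/
theorem measure_coverageEvent_of_isFirstAnnulus (hα : 0 < α) (hh : 0 < h) (hθ : 0 < θ)
    {g : ℕ → Ω → ℝ} (hm : ∀ i, Measurable (g i)) (hlaw : ∀ i, P.map (g i) = expMeasure 1)
    (hind : iIndepFun g P) {y : ℕ → EuclideanSpace ℝ (Fin 2)} {ε : ℝ} (hε : 0 < ε) {k : ℕ}
    (hy : IsFirstAnnulus ε y k) :
    negExp (∑' n : ℕ, ENNReal.ofReal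
        (Real.log (1 + θ * (1 + ε / ((k + 1) * ε + h ^ 2) * n) ^ (-(α / 2)))) *
          annulusCount ε y (k + 1 + n)) ≤ P (coverageEvent α h θ y g) ∧
    P (coverageEvent α h θ y g) ≤ negExp (∑' n : ℕ, ENNReal.ofReal
        (Real.log (1 + θ * (1 + ε / (k * ε + h ^ 2) * (n + 2 : ℕ)) ^ (-(α / 2)))) *
          annulusCount ε y (k + 1 + n)) := by
  obtain ⟨i, hi, hj⟩ := hy.exists_index
  rw [measure_coverageEvent_of_closest hh hθ hm hlaw hind
    (fun j hne => norm_lt_of_first_annulus hε hi (hj j hne)),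
    tsum_mul_annulusCount hi hj (fun n => ENNReal.ofReal
      (Real.log (1 + θ * (1 + ε / ((k + 1) * ε + h ^ 2) * n) ^ (-(α / 2))))),
    tsum_mul_annulusCount hi hj (fun n => ENNReal.ofReal
      (Real.log (1 + θ * (1 + ε / (k * ε + h ^ 2) * (n + 2 : ℕ)) ^ (-(α / 2)))))]
  obtain ⟨hi1, hi2⟩ := (mem_annulus_iff hε).1 hi
  have hh2 : 0 < h ^ 2 := by positivity
  have hk : (0 : ℝ) ≤ k * ε := by positivity
  constructor <;> refine antitone_negExp (ENNReal.tsum_le_tsum fun j => ENNReal.ofReal_le_ofReal ?_)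
  all_goals
    rw [pathloss_div_pathloss hh]
    obtain ⟨hj1, hj2⟩ := (mem_annulus_iff hε).1
      (show y j ∈ annulus ε ⌊‖y j‖ ^ 2 / ε⌋₊ from rfl)
    obtain ⟨n, hn⟩ := Nat.exists_eq_add_of_le (hj j j.2)
    rw [hn] at hj1 hj2 ⊢
    rw [Nat.add_sub_cancel_left]
    push_cast at hj1 hj2 ⊢
    refine log_one_add_mul_rpow_neg_le (by linarith) hθ (by positivity) ?_
  · have : 1 + ε / ((k + 1) * ε + h ^ 2) * n =
        ((k + 1 + n) * ε + h ^ 2) / ((k + 1) * ε + h ^ 2) := by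
      field_simp
      ring
    rw [this]
    gcongr
  · have : 1 + ε / (k * ε + h ^ 2) * (n + 2) =
        ((k + 1 + n + 1) * ε + h ^ 2) / (k * ε + h ^ 2) := by
      field_simp
      ring
    rw [this]
    gcongr

variable {x : ℕ → Ω → EuclideanSpace ℝ (Fin 2)} {g : ℕ → Ω → ℝ}

theorem IsRayleighNetwork.setLIntegral_coverageEvent_bounds [IsProbabilityMeasure P]
    (hN : IsRayleighNetwork lam x g P) (hlam : 0 < lam) (hα : 2 < α) (hh : 0 < h) (hθ : 0 < θ)
    {ε r K : ℝ} (hε : 0 < ε) (hr : r = lam * (Real.pi * ε))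
    (hK : K = ∫ u in Ioi (1 : ℝ), interferenceKernel (α / 2) θ u) (k : ℕ) :
    ENNReal.ofReal (Real.exp (-r - lam * Real.pi * h ^ 2 * K) * (r * Real.exp (-(r * (1 + K))) *
        Real.exp (-(r * (1 + K))) ^ k)) ≤
      ∫⁻ ω in {ω | IsFirstAnnulus ε (fun i => x i ω) k},
        P (coverageEvent α h θ (fun i => x i ω) g) ∂P ∧
    ∫⁻ ω in {ω | IsFirstAnnulus ε (fun i => x i ω) k},
        P (coverageEvent α h θ (fun i => x i ω) g) ∂P ≤
      ENNReal.ofReal (Real.exp (r - lam * Real.pi * h ^ 2 * K) * (r *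
        Real.exp (-(r * (1 + K))) ^ k)) := by
  have hb : 1 < α / 2 := by linarith
  have hh2 : 0 < h ^ 2 := by positivity
  have hA := measurableSet_isFirstAnnulus hN.poisson.measurable ε k
  have hbd := fun ω (hω : IsFirstAnnulus ε (fun i => x i ω) k) =>
    measure_coverageEvent_of_isFirstAnnulus (by linarith) hh hθ hN.measurable_gain hN.gain_law
      hN.gain_indep hε hω (α := α)
  have hlog : ∀ u : ℝ, 0 < u → 0 ≤ Real.log (1 + θ * u ^ (-(α / 2))) := fun u hu => by
    have : 0 < u ^ (-(α / 2)) := by positivity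
    exact Real.log_nonneg (by nlinarith)
  have hr0 : 0 < r := by rw [hr]; positivity
  constructor
  · set a := (k + 1) * ε + h ^ 2 with ha
    have ha0 : 0 < a := by positivity
    have hτ : 0 < ε / a := by positivity
    have hu : ∀ n : ℕ, 0 < 1 + ε / a * n := fun n => by positivity
    refine le_trans ?_ (setLIntegral_mono' hA fun ω hω => (hbd ω hω).1)
    rw [hN.poisson.setLIntegral_negExp_tsum hlam hε k (fun n => hlog _ (hu n))
      (by simpa only [one_sub_exp_neg_log_one_add hθ (hu _)] using
        summable_interferenceKernel hb hθ hτ)]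
    simp_rw [one_sub_exp_neg_log_one_add hθ (hu _)]
    have hR := riemannSum_le_integral hb hθ hτ
    rw [← hK] at hR
    set S := ∑' n : ℕ, interferenceKernel (α / 2) θ (1 + ε / a * n)
    have hS : ε * S ≤ ε + a * K := by
      have := mul_le_mul_of_nonneg_left hR ha0.le
      field_simp at this
      linarith
    -- The step of the Riemann sum is ε/a, so r S is about λπaK. The part of a linear in k will feed
    -- the geometric series, and h² gives the factor exp(-λπh²K).
    have hS2 : r * S ≤ r + r * (k + 1) * K + lam * Real.pi * h ^ 2 * K := by
      have := mul_le_mul_of_nonneg_left hS (by positivity : 0 ≤ lam * Real.pi)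
      rw [hr]
      rw [ha] at this
      linarith
    refine ENNReal.ofReal_le_ofReal ?_
    rw [← hr, ← Real.exp_nat_mul]
    have e1 : Real.exp (-r - lam * Real.pi * h ^ 2 * K) * (r * Real.exp (-(r * (1 + K))) *
        Real.exp (k * -(r * (1 + K)))) = r * (Real.exp (-r - lam * Real.pi * h ^ 2 * K +
          -(r * (1 + K)) + k * -(r * (1 + K)))) := by
      rw [Real.exp_add, Real.exp_add]
      ring
    rw [e1, mul_assoc r, ← Real.exp_add]
    refine mul_le_mul_of_nonneg_left (Real.exp_le_exp.2 ?_) hr0.le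
    linarith
  · set a := k * ε + h ^ 2 with ha
    have ha0 : 0 < a := by positivity
    have hτ : 0 < ε / a := by positivity
    have hu : ∀ n : ℕ, 0 < 1 + ε / a * (n + 2 : ℕ) := fun n => by positivity
    refine (setLIntegral_mono' hA fun ω hω => (hbd ω hω).2).trans ?_
    rw [hN.poisson.setLIntegral_negExp_tsum hlam hε k (fun n => hlog _ (hu n))
      (by simpa only [one_sub_exp_neg_log_one_add hθ (hu _)] using
        (summable_nat_add_iff 2).2 (summable_interferenceKernel hb hθ hτ))]
    simp_rw [one_sub_exp_neg_log_one_add hθ (hu _)]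
    have hR := integral_sub_le_shifted_riemannSum hb hθ hτ
    rw [← hK] at hR
    set S := ∑' n : ℕ, interferenceKernel (α / 2) θ (1 + ε / a * (n + 2 : ℕ))
    have hS : a * K - 2 * ε ≤ ε * S := by
      have := mul_le_mul_of_nonneg_left hR ha0.le
      field_simp at this
      linarith
    have hS2 : r * k * K + lam * Real.pi * h ^ 2 * K - 2 * r ≤ r * S := by
      have := mul_le_mul_of_nonneg_left hS (by positivity : 0 ≤ lam * Real.pi)
      rw [hr]
      rw [ha] at this
      linarith
    refine ENNReal.ofReal_le_ofReal ?_
    rw [← hr, ← Real.exp_nat_mul]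
    have e1 : Real.exp (r - lam * Real.pi * h ^ 2 * K) * (r *
        Real.exp (k * -(r * (1 + K)))) = r * (Real.exp (r - lam * Real.pi * h ^ 2 * K +
          k * -(r * (1 + K)))) := by
      rw [Real.exp_add]
      ring
    rw [e1, mul_assoc r, ← Real.exp_add]
    refine mul_le_mul_of_nonneg_left (Real.exp_le_exp.2 ?_) hr0.le
    linarith

theorem IsPoissonPointProcess.measure_isFirstAnnulus [IsProbabilityMeasure P]
    (hX : IsPoissonPointProcess lam x P) (hlam : 0 < lam) {ε r : ℝ} (hε : 0 < ε)
    (hr : r = lam * (Real.pi * ε)) (k : ℕ) :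
    P {ω | IsFirstAnnulus ε (fun i => x i ω) k} =
      ENNReal.ofReal (r * Real.exp (-r) * Real.exp (-r) ^ k) := by
  -- With no outer annuli the integrand is 1 and the integral is the probability of the event.
  have h := hX.setLIntegral_negExp_sum hlam hε k 0 (l := 0) (by simp)
  simp only [Finset.range_zero, Finset.sum_empty, negExp_zero, mul_zero, neg_zero, Real.exp_zero,
    mul_one, lintegral_one, Measure.restrict_apply_univ] at h
  rw [h, ← hr, ← Real.exp_nat_mul, mul_assoc, ← Real.exp_add]
  ring_nf

theorem IsRayleighNetwork.coverageProbClosest_bounds [IsProbabilityMeasure P]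
    (hN : IsRayleighNetwork lam x g P) (hlam : 0 < lam) (hα : 2 < α) (hh : 0 < h) (hθ : 0 < θ)
    {r K : ℝ} (hr : 0 < r)
    (hK : K = ∫ u in Ioi (1 : ℝ), interferenceKernel (α / 2) θ u) :
    Real.exp (-r - lam * Real.pi * h ^ 2 * K) *
        (r / (1 - Real.exp (-(r * (1 + K)))) * Real.exp (-(r * (1 + K)))) ≤
      coverageProbClosest α h θ x g P ∧
    coverageProbClosest α h θ x g P ≤
      Real.exp (r - lam * Real.pi * h ^ 2 * K) * (r / (1 - Real.exp (-(r * (1 + K))))) +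
        (1 - r / (1 - Real.exp (-r)) * Real.exp (-r)) := by
  obtain ⟨ε, hε, hrε⟩ : ∃ ε : ℝ, 0 < ε ∧ r = lam * (Real.pi * ε) :=
    ⟨r / (lam * Real.pi), by positivity, by field_simp⟩
  have hK0 : 0 < K := hK ▸ integral_interferenceKernel_pos (by linarith) hθ
  have hq1 : Real.exp (-(r * (1 + K))) < 1 := Real.exp_lt_one_iff.2 (by nlinarith)
  have hq2 : Real.exp (-r) < 1 := Real.exp_lt_one_iff.2 (by linarith)
  have hA := fun k => measurableSet_isFirstAnnulus hN.poisson.measurable ε k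
  have hdisj := pairwise_disjoint_isFirstAnnulus x ε
  have hbd := hN.setLIntegral_coverageEvent_bounds hlam hα hh hθ hε hrε hK
  have hcov := hN.measure_coverage α h θ
  have hU := lintegral_iUnion hA hdisj (μ := P)
    (fun ω => P (coverageEvent α h θ (fun i => x i ω) g))
  have hPU : P (⋃ k, {ω | IsFirstAnnulus ε (fun i => x i ω) k}) =
      ENNReal.ofReal (r / (1 - Real.exp (-r)) * Real.exp (-r)) := by
    rw [measure_iUnion hdisj hA]
    simp_rw [hN.poisson.measure_isFirstAnnulus hlam hε hrε]
    rw [tsum_ofReal_mul_geometric (by positivity) (by positivity) hq2]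
    congr 1
    ring
  have hd1 : 0 < 1 - Real.exp (-(r * (1 + K))) := by linarith
  have hd2 : 0 < 1 - Real.exp (-r) := by linarith
  rw [coverageProbClosest, measureReal_def]
  constructor
  · rw [← ENNReal.ofReal_le_iff_le_toReal (measure_ne_top _ _), hcov]
    refine le_trans ?_ (setLIntegral_le_lintegral
      (⋃ k, {ω | IsFirstAnnulus ε (fun i => x i ω) k}) _)
    rw [hU]
    refine le_trans (le_of_eq ?_) (ENNReal.tsum_le_tsum fun k => (hbd k).1)
    simp_rw [← mul_assoc]
    rw [tsum_ofReal_mul_geometric (by positivity) (by positivity) hq1]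
    congr 1
    ring
  · have hPle : r / (1 - Real.exp (-r)) * Real.exp (-r) ≤ 1 := by
      rw [← ENNReal.ofReal_le_one, ← hPU]
      exact prob_le_one
    refine ENNReal.toReal_le_of_le_ofReal
      (add_nonneg (by positivity) (sub_nonneg.2 hPle)) ?_
    rw [hcov, ← lintegral_add_compl _ (MeasurableSet.iUnion hA), hU,
      ENNReal.ofReal_add (by positivity) (sub_nonneg.2 hPle)]
    refine add_le_add ?_ ?_
    · refine (ENNReal.tsum_le_tsum fun k => (hbd k).2).trans (le_of_eq ?_)
      simp_rw [← mul_assoc]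
      rw [tsum_ofReal_mul_geometric (by positivity) (by positivity) hq1]
      congr 1
      ring
    -- Off the events A_k coverage is bounded by 1; the mass of this complement vanishes as r → 0.
    · refine (lintegral_mono fun ω => prob_le_one).trans ?_
      rw [lintegral_one, Measure.restrict_apply_univ,
        prob_compl_eq_one_sub (MeasurableSet.iUnion hA), hPU,
        ENNReal.ofReal_sub _ (by positivity), ENNReal.ofReal_one]

end Coverage

/-! ### The limit of fine annuli and the closed form. -/

/-- The quotient is the inverse of the difference quotient at 0 of 1 - exp(-rc), whose derivative
there is c. -/
theorem tendsto_div_one_sub_exp_neg_mul {c : ℝ} (hc : 0 < c) :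
    Tendsto (fun r : ℝ => r / (1 - Real.exp (-(r * c)))) (𝓝[>] 0) (𝓝 (1 / c)) := by
  have hd : HasDerivAt (fun r : ℝ => 1 - Real.exp (-(r * c))) c 0 := by
    have := (((hasDerivAt_id (0 : ℝ)).mul_const c).neg.exp).const_sub 1
    simpa using this
  have h := (hd.tendsto_slope_zero_right).inv₀ hc.ne'
  simp only [zero_add, zero_mul, neg_zero, Real.exp_zero, sub_self, sub_zero, smul_eq_mul,
    mul_inv, inv_inv] at h
  rw [one_div]
  exact h.congr fun r => by rw [div_eq_mul_inv]

/-- The coverage probability does not depend on the mesh r, so the bounds squeeze it to their common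
limit as r → 0 from the right. -/
theorem IsRayleighNetwork.coverageProbClosest_eq {Ω : Type*} [MeasurableSpace Ω] {P : Measure Ω}
    [IsProbabilityMeasure P] {α h θ lam : ℝ} {x : ℕ → Ω → EuclideanSpace ℝ (Fin 2)}
    {g : ℕ → Ω → ℝ} (hN : IsRayleighNetwork lam x g P) (hlam : 0 < lam) (hα : 2 < α)
    (hh : 0 < h) (hθ : 0 < θ) :
    coverageProbClosest α h θ x g P =
      Real.exp (-(Real.pi * h ^ 2 * (eta α θ 1 1 - 1) * lam)) / eta α θ 1 1 := by
  obtain ⟨K, hK⟩ : ∃ K : ℝ, K = ∫ u in Ioi (1 : ℝ), interferenceKernel (α / 2) θ u := ⟨_, rfl⟩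
  have hK0 : 0 < K := hK ▸ integral_interferenceKernel_pos (by linarith) hθ
  rw [eta_one_one hα hθ, ← hK]
  have hcont : ∀ f : ℝ → ℝ, Continuous f → Tendsto f (𝓝[>] 0) (𝓝 (f 0)) := fun f hf =>
    (hf.tendsto 0).mono_left nhdsWithin_le_nhds
  have hlimK := tendsto_div_one_sub_exp_neg_mul (by linarith : 0 < 1 + K)
  have hlim1 := tendsto_div_one_sub_exp_neg_mul one_pos
  have hval : Real.exp (-(lam * Real.pi * h ^ 2 * K)) * (1 / (1 + K)) =
      Real.exp (-(Real.pi * h ^ 2 * (1 + K - 1) * lam)) / (1 + K) := by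
    rw [mul_one_div]
    ring_nf
  rw [← hval]
  apply le_antisymm
  · have h1 := ((hcont (fun r => Real.exp (r - lam * Real.pi * h ^ 2 * K)) (by fun_prop)).mul
      hlimK).add ((hlim1.mul (hcont (fun r => Real.exp (-r)) (by fun_prop))).const_sub 1)
    simp only [zero_sub, neg_zero, Real.exp_zero, mul_one, div_one, sub_self, add_zero] at h1
    refine ge_of_tendsto h1 ?_
    filter_upwards [self_mem_nhdsWithin] with r hr
    exact (hN.coverageProbClosest_bounds hlam hα hh hθ hr hK).2
  · have h1 := (hcont (fun r => Real.exp (-r - lam * Real.pi * h ^ 2 * K)) (by fun_prop)).mul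
      (hlimK.mul (hcont (fun r => Real.exp (-(r * (1 + K)))) (by fun_prop)))
    simp only [zero_sub, neg_zero, Real.exp_zero, mul_one, zero_mul] at h1
    refine le_of_tendsto h1 ?_
    filter_upwards [self_mem_nhdsWithin] with r hr
    exact (hN.coverageProbClosest_bounds hlam hα hh hθ hr hK).1

end

/-! ### The optimal density. -/

theorem mainTheorem5 (α θ : ℝ) (hα : 2 < α) (hθ : 0 < θ) :
    ∃ C : ℝ, 0 < C ∧
      ∀ (Ω : ℝ → Type*) [∀ lam, MeasurableSpace (Ω lam)]
        (P : ∀ lam, MeasureTheory.Measure (Ω lam))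
        [∀ lam, MeasureTheory.IsProbabilityMeasure (P lam)]
        (x : ∀ lam, ℕ → Ω lam → EuclideanSpace ℝ (Fin 2)) (g : ∀ lam, ℕ → Ω lam → ℝ),
        (∀ lam, 0 < lam → IsRayleighNetwork lam (x lam) (g lam) (P lam)) →
        ∀ h : ℝ, 0 < h →
          {lam : ℝ | lam ∈ Set.Ioi 0 ∧
              IsMaxOn (fun l => aseClosest α h θ l (x l) (g l) (P l)) (Set.Ioi 0) lam} =
            {lamOpt α h θ} ∧
          aseClosest α h θ (lamOpt α h θ) (x (lamOpt α h θ)) (g (lamOpt α h θ))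
              (P (lamOpt α h θ)) =
            Real.exp (-1) * Real.logb 2 (1 + θ) /
              (Real.pi * h ^ 2 * eta α θ 1 1 * (eta α θ 1 1 - 1)) ∧
          aseClosest α h θ (lamOpt α h θ) (x (lamOpt α h θ)) (g (lamOpt α h θ))
              (P (lamOpt α h θ)) = C * (1 / h ^ 2) := by
  have hη : 0 < eta α θ 1 1 - 1 := by
    rw [eta_one_one hα hθ, add_sub_cancel_left]
    exact integral_interferenceKernel_pos (by linarith) hθ
  have hη0 : 0 < eta α θ 1 1 := by linarith
  have hlog : 0 < Real.logb 2 (1 + θ) := Real.logb_pos one_lt_two (by linarith)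
  -- The constant is the maximal value with h² removed; it is fixed before the networks and h are
  -- introduced.
  refine ⟨Real.exp (-1) * Real.logb 2 (1 + θ) / (Real.pi * eta α θ 1 1 * (eta α θ 1 1 - 1)),
    by positivity, fun Ω _ P _ x g hN h hh => ?_⟩
  have ha : 0 < Real.pi * h ^ 2 * (eta α θ 1 1 - 1) := by positivity
  have hf : ∀ l, 0 < l → aseClosest α h θ l (x l) (g l) (P l) =
      l * Real.exp (-(Real.pi * h ^ 2 * (eta α θ 1 1 - 1) * l)) *
        (Real.logb 2 (1 + θ) / eta α θ 1 1) := fun l hl => by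
    rw [aseClosest, (hN l hl).coverageProbClosest_eq hl hα hh hθ]
    ring
  have hval : aseClosest α h θ (lamOpt α h θ) (x (lamOpt α h θ)) (g (lamOpt α h θ))
      (P (lamOpt α h θ)) = Real.exp (-1) * Real.logb 2 (1 + θ) /
        (Real.pi * h ^ 2 * eta α θ 1 1 * (eta α θ 1 1 - 1)) := by
    rw [hf (lamOpt α h θ) (one_div_pos.2 ha), lamOpt, mul_one_div_cancel ha.ne']
    field_simp
  refine ⟨setOf_isMaxOn_mul_exp_neg ha (by positivity) hf, hval, ?_⟩
  rw [hval]
  field_simp
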